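/- Fix integers $k\ge 1$ and $m>1$. For $1\le i\le k$ let $R_i=(i^{k+1-i})$ be the rectangular partition with $k+1-i$ parts equal to $i$; for partitions $\lambda,\mu$ let $\lambda\cup\mu$ be the partition whose multiset of parts is the union (with multiplicities added) of those of $\lambda$ and $\mu$. Let $Y^k_m$ be the set of ($k$-bounded) partitions $\lambda$ whose Young diagram is contained in that of $R_{i_1}\cup\dots\cup R_{i_{m-1}}$ for some $i_1,\dots,i_{m-1}\in\{1,\dots,k\}$. *Cores.* For a $(k+1)$-core $\mu$ (a partition with no hook length equal to $k+1$) let $\mathfrak p(\mu)$ be the $k$-bounded partition whose $r$-th part is the number of cells in row $r$ of $\mu$ with hook length less than $k+1$; $\mathfrak p$ is a bijection from $(k+1)$-cores to $k$-bounded partitions, with inverse $\mathfrak c$. For $i\in\mathbb Z/(k+1)$ let $s_i$ act on $(k+1)$-cores by adding all addable cells of content $i$ modulo $k+1$ if there is one, and otherwise by removing all removable cells of content $i$ modulo $k+1$. The $k$-Young lattice on $k$-bounded partitions has the covering relation $\lambda\lessdot\mu$ if $|\mu|=|\lambda|+1$ and $s_i\mathfrak c(\lambda)=\mathfrak c(\mu)$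 for some $i$. *Alcoves.* Let $V$ be the real vector space with basis the simple roots $\alpha_1,\dots,\alpha_k$ of type $A_k$, with the bilinear form given by the Cartan matrix, let $\Lambda_1,\dots,\Lambda_k$ be the dual basis, $\phi=\alpha_1+\dots+\alpha_k$, $C=\{x:\langle\alpha_i,x\rangle\ge 0 \text{ for all } i\}$ and $A_\emptyset=\{x\in C:\langle\phi,x\rangle\le 1\}$. The affine Weyl group $W$ is generated by the reflections $s_i$ in $\langle\alpha_i,x\rangle=0$ ($1\le i\le k$) and $s_0$ in $\langle\phi,x\rangle=1$; the alcoves are the sets $A_w=w^{-1}A_\emptyset$, $w\in W$. A $k$-bounded partition $\lambda$ corresponds to an alcove $A\subseteq C$ if $A=A_w$ and $w\emptyset=\mathfrak c(\lambda)$ for some $w\in W$, where $w=s_{i_1}\cdots s_{i_r}$ acts on cores by $s_{i_1}\cdots s_{i_r}$. **Theorem.** This correspondence restricts to a bijection between $Y^k_m$ and the set of alcoves $A\subseteq C$ with $\langle\phi,x\rangle\le m$ for all $x\in A$, i.e. the alcoves contained in the $m$-fold dilation $mA_\emptyset$: each element of either set corresponds to exactly one alcove, respectively partition, and this one lies in the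 other set. There are an affine automorphism $\rho$ of $V$ that rotates the vertices of $mA_\emptyset$, $$0\mapsto m\Lambda_1\mapsto m\Lambda_2\mapsto\dots\mapsto m\Lambda_k\mapsto 0,$$ and a permutation $\sigma$ of $Y^k_m$ such that, if $\lambda\in Y^k_m$ corresponds to $A$, then $\sigma(\lambda)$ corresponds to $\rho(A)$. The permutation $\sigma$ has order exactly $k+1$, so it defines a faithful action of the cyclic group of order $k+1$ on $Y^k_m$, and it is an automorphism of the Hasse diagram of $Y^k_m$ in the $k$-Young lattice, as an undirected graph. For $m=2$ it is Suter's symmetry of $Y^k_2=\{\lambda:\lambda\subseteq R_i\text{ for some }i\}$: $\sigma(\lambda)$ is obtained from $\lambda$ by deleting the first part $\lambda_1$ (with $\lambda_1=0$ if $\lambda=\emptyset$) and putting a column of $k-\lambda_1$ cells to the left of the remaining diagram. -/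

import Mathlib

namespace KBounded

/-! ### Partitions, hooks and cores

A partition is a `YoungDiagram`; the cell in row `r` and column `c` (both counted from `0`) is
`(r, c)`, and `lam.rowLen r` is the part of index `r`. -/

/-- The partition whose multiset of (non-zero) parts is `s`. -/
def ofParts (s : Multiset ℕ) : YoungDiagram :=
  YoungDiagram.ofRowLens (s.sort (· ≥ ·))
    (List.sortedGE_iff_pairwise.mpr (Multiset.pairwise_sort s (· ≥ ·)))

/-- The parts of the `k`-rectangle `R_i = (i^{k+1-i})`. -/
def rectParts (k i : ℕ) : Multiset ℕ := Multiset.replicate (k + 1 - i) i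

/-- `lam` is `k`-bounded: all its parts are at most `k`. -/
def IsKBounded (k : ℕ) (lam : YoungDiagram) : Prop := ∀ r, lam.rowLen r ≤ k

/-- The set `Y^k_m` of `k`-bounded partitions contained in some `R_{i_1} ∪ ⋯ ∪ R_{i_{m-1}}` with
`1 ≤ i_j ≤ k`; the union of partitions is the partition whose multiset of parts is the sum of
their multisets of parts. -/
def Y (k m : ℕ) : Set YoungDiagram :=
  {lam | IsKBounded k lam ∧ ∃ i : Fin (m - 1) → ℕ, (∀ j, 1 ≤ i j ∧ i j ≤ k) ∧
    lam ≤ ofParts (∑ j, rectParts k (i j))}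

/-- The hook length of a cell of `mu`. -/
def hook (mu : YoungDiagram) (r c : ℕ) : ℕ := (mu.rowLen r - c) + (mu.colLen c - r) - 1

/-- `mu` is a `(k+1)`-core: no cell has hook length `k+1`. -/
def IsCore (k : ℕ) (mu : YoungDiagram) : Prop := ∀ r c, (r, c) ∈ mu → hook mu r c ≠ k + 1

/-- `mu` is a `(k+1)`-core and `lam` is the `k`-bounded partition corresponding to it: the part of
`lam` of index `r` is the number of cells in row `r` of `mu` with hook length less than `k+1`.
That is, `lam = 𝔭(mu)` and `mu = 𝔠(lam)`. -/
def IsCoreOf (k : ℕ) (mu lam : YoungDiagram) : Prop :=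
  IsCore k mu ∧
    ∀ r, lam.rowLen r = ((Finset.range (mu.rowLen r)).filter fun c => hook mu r c < k + 1).card

/-- The cell `x` can be added to `mu`. -/
def IsAddable (mu : YoungDiagram) (x : ℕ × ℕ) : Prop :=
  x ∉ mu ∧ IsLowerSet (insert x (mu.cells : Set (ℕ × ℕ)))

/-- The cell `x` can be removed from `mu`. -/
def IsRemovable (mu : YoungDiagram) (x : ℕ × ℕ) : Prop :=
  x ∈ mu ∧ IsLowerSet ((mu.cells : Set (ℕ × ℕ)) \ {x})

/-- The content of the cell `x` is `i` modulo `k+1`. -/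
def HasContent {k : ℕ} (i : Fin (k + 1)) (x : ℕ × ℕ) : Prop :=
  (x.2 : ℤ) - (x.1 : ℤ) ≡ ((i : ℕ) : ℤ) [ZMOD ((k + 1 : ℕ) : ℤ)]

lemma IsAddable.le {mu : YoungDiagram} {x : ℕ × ℕ} (h : IsAddable mu x) :
    x.1 < mu.colLen 0 + 1 ∧ x.2 < mu.rowLen 0 + 1 := by
  obtain ⟨a, b⟩ := x
  obtain ⟨-, h2⟩ := h
  constructor
  · rcases a with _ | a
    · simp
    · have := h2 (a := (a + 1, b)) (b := (a, 0)) (by simp [Prod.le_def]) (by simp)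
      simp only [Set.mem_insert_iff, Prod.mk.injEq, Finset.mem_coe, YoungDiagram.mem_cells] at this
      rcases this with h | h
      · omega
      · have := YoungDiagram.mem_iff_lt_colLen.mp h
        simp only; omega
  · rcases b with _ | b
    · simp
    · have := h2 (a := (a, b + 1)) (b := (0, b)) (by simp [Prod.le_def]) (by simp)
      simp only [Set.mem_insert_iff, Prod.mk.injEq, Finset.mem_coe, YoungDiagram.mem_cells] at this
      rcases this with h | h
      · omega
      · have := YoungDiagram.mem_iff_lt_rowLen.mp h
        simp only; omega

open Classical in
/-- `mu` together with all its addable cells of content `i`. -/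
noncomputable def addCells {k : ℕ} (i : Fin (k + 1)) (mu : YoungDiagram) : YoungDiagram where
  cells := mu.cells ∪
    ((Finset.range (mu.colLen 0 + 1) ×ˢ Finset.range (mu.rowLen 0 + 1)).filter
      fun x => IsAddable mu x ∧ HasContent i x)
  isLowerSet := by
    intro a b hba ha
    simp only [Finset.coe_union, Set.mem_union, Finset.mem_coe, Finset.mem_filter] at ha ⊢
    rcases ha with ha | ⟨h1, h2, h3⟩
    · exact Or.inl (mu.isLowerSet hba ha)
    · have := h2.2 hba (Set.mem_insert _ _)
      rcases this with rfl | h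
      · exact Or.inr ⟨h1, h2, h3⟩
      · exact Or.inl h

open Classical in
/-- `mu` without its removable cells of content `i`. -/
noncomputable def removeCells {k : ℕ} (i : Fin (k + 1)) (mu : YoungDiagram) : YoungDiagram where
  cells := mu.cells.filter fun x => ¬ (IsRemovable mu x ∧ HasContent i x)
  isLowerSet := by
    intro a b hba ha
    simp only [Finset.coe_filter, Set.mem_ofPred_eq] at ha ⊢
    refine ⟨mu.isLowerSet hba ha.1, fun h => ?_⟩
    by_cases hab : a = b
    · subst hab; exact ha.2 h
    · have := h.1.2 hba ⟨ha.1, hab⟩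
      exact this.2 rfl

lemma mem_addCells {k : ℕ} (i : Fin (k + 1)) (mu : YoungDiagram) (x : ℕ × ℕ) :
    x ∈ addCells i mu ↔ x ∈ mu ∨ (IsAddable mu x ∧ HasContent i x) := by
  rw [← YoungDiagram.mem_cells, ← YoungDiagram.mem_cells]
  simp only [addCells, Finset.mem_union, Finset.mem_filter, Finset.mem_product, Finset.mem_range]
  exact ⟨fun h => h.imp id And.right, fun h => h.imp id fun h => ⟨h.1.le, h⟩⟩

lemma mem_removeCells {k : ℕ} (i : Fin (k + 1)) (mu : YoungDiagram) (x : ℕ × ℕ) :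
    x ∈ removeCells i mu ↔ x ∈ mu ∧ ¬ (IsRemovable mu x ∧ HasContent i x) := by
  rw [← YoungDiagram.mem_cells, ← YoungDiagram.mem_cells]
  simp only [removeCells, Finset.mem_filter]

open Classical in
/-- The action of the generator `s_i` on `(k+1)`-cores: add all addable cells of content `i` if
there is one, otherwise remove all removable cells of content `i` (possibly none). -/
noncomputable def coreAct {k : ℕ} (i : Fin (k + 1)) (mu : YoungDiagram) : YoungDiagram :=
  if ∃ x, IsAddable mu x ∧ HasContent i x then addCells i mu else removeCells i mu

/-- `s_{i_1} ⋯ s_{i_r} ∅` for the word `l = [i_1, …, i_r]`. -/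
noncomputable def wordCore {k : ℕ} (l : List (Fin (k + 1))) : YoungDiagram :=
  l.foldr coreAct ⊥

/-- The covering relation `lam ⋖ mu` of the `k`-Young lattice. -/
def KCovers (k : ℕ) (lam mu : YoungDiagram) : Prop :=
  lam.card + 1 = mu.card ∧ ∃ κ ν : YoungDiagram, IsCoreOf k κ lam ∧ IsCoreOf k ν mu ∧
    ∃ i : Fin (k + 1), coreAct i κ = ν

/-- The (undirected) edges of the Hasse diagram of the `k`-Young lattice. -/
def HasseAdj (k : ℕ) (lam mu : YoungDiagram) : Prop := KCovers k lam mu ∨ KCovers k mu lam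

/-! ### The affine Weyl group of type `A_k` and its alcoves

`V k` is the real vector space with basis the simple roots; the simple root
`α_i`, `1 ≤ i ≤ k`, has index `i - 1 : Fin k`. -/

/-- The space spanned by the simple roots, in coordinates with respect to them. -/
abbrev V (k : ℕ) : Type := Fin k → ℝ

/-- The symmetric bilinear form on `V k` whose Gram matrix is the Cartan matrix of type `A_k`. -/
noncomputable def form (k : ℕ) : LinearMap.BilinForm ℝ (V k) :=
  Matrix.toBilin' ((CartanMatrix.A k).map (fun z : ℤ => (z : ℝ)))

/-- The simple roots. -/
def simpleRoot {k : ℕ} (i : Fin k) : V k := Pi.single i 1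

/-- The highest root `φ = α_1 + ⋯ + α_k`. -/
def highestRoot (k : ℕ) : V k := ∑ i, simpleRoot i

/-- The fundamental weights, the basis dual to the simple roots
(see `form_simpleRoot_fundamentalWeight`). -/
noncomputable def fundamentalWeight {k : ℕ} (i : Fin k) : V k := fun j =>
  min ((i : ℝ) + 1) ((j : ℝ) + 1) - ((i : ℝ) + 1) * ((j : ℝ) + 1) / ((k : ℝ) + 1)

/-- The orthogonal reflection of `V k` in the affine hyperplane `⟨α, x⟩ = p`. -/
noncomputable def reflection {k : ℕ} (α : V k) (p : ℝ) : Equiv.Perm (V k) :=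
  Function.Involutive.toPerm
    (fun x => x - (2 * (form k α x - p) / form k α α) • α) (by
      intro x
      simp only [map_sub, map_smul, smul_eq_mul]
      by_cases h : form k α α = 0
      · simp [h]
      · rw [sub_sub, ← add_smul]
        have : 2 * (form k α x - p) / form k α α +
          2 * (form k α x - 2 * (form k α x - p) / form k α α * form k α α - p) / form k α α
            = 0 := by
          field_simp
          ring
        rw [this]; simp)

/-- The generators of the affine Weyl group: `s_0` is the reflection in `H_{φ,1}` and, for
`1 ≤ i ≤ k`, `s_i` is the reflection in `H_{α_i,0}`. -/
noncomputable def gen {k : ℕ} : Fin (k + 1) → Equiv.Perm (V k) :=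
  Fin.cases (reflection (highestRoot k) 1) (fun i => reflection (simpleRoot i) 0)

/-- The affine Weyl group of type `A_k`, acting on `V k`. -/
noncomputable def affineWeyl (k : ℕ) : Subgroup (Equiv.Perm (V k)) :=
  Subgroup.closure (Set.range gen)

/-- The (closed) dominant chamber. -/
def dominantChamber (k : ℕ) : Set (V k) := {x | ∀ i, 0 ≤ form k (simpleRoot i) x}

/-- The (closed) fundamental alcove. -/
def fundamentalAlcove (k : ℕ) : Set (V k) := {x ∈ dominantChamber k | form k (highestRoot k) x ≤ 1}

/-- The alcove `A_w = w⁻¹ A_∅`. -/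
def alcove {k : ℕ} (w : Equiv.Perm (V k)) : Set (V k) := (⇑w⁻¹) '' fundamentalAlcove k

/-- The set of alcoves in the dominant chamber that are bounded by `H_{φ,m}`, that is, the alcoves
contained in the `m`-fold dilation of the fundamental alcove. -/
def dominantAlcoves (k m : ℕ) : Set (Set (V k)) :=
  {A | (∃ w ∈ affineWeyl k, A = alcove w) ∧ A ⊆ dominantChamber k ∧
    ∀ x ∈ A, form k (highestRoot k) x ≤ m}

/-- The partition `lam` corresponds to the dominant alcove `A`: for some
`w = s_{i_1} ⋯ s_{i_r}` one has `A = A_w` and `w ∅ = 𝔠(lam)`. -/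
def Corresponds (k : ℕ) (lam : YoungDiagram) (A : Set (V k)) : Prop :=
  A ⊆ dominantChamber k ∧
    ∃ l : List (Fin (k + 1)), A = alcove (l.map gen).prod ∧ IsCoreOf k (wordCore l) lam

/-- The vertices `0, mΛ_1, …, mΛ_k` of the `m`-fold dilation of the fundamental alcove. -/
noncomputable def dilatedVertex (k m : ℕ) : Fin (k + 1) → V k :=
  Fin.cases 0 (fun i => (m : ℝ) • fundamentalWeight i)

lemma form_simpleRoot (k : ℕ) (i : Fin k) (x : V k) :
    form k (simpleRoot i) x = ∑ j, (CartanMatrix.A k i j : ℝ) * x j := by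
  simp [form, simpleRoot, Matrix.toBilin'_apply', Matrix.mulVec, dotProduct, Pi.single_apply]

lemma sum_cartan (k : ℕ) (i : Fin k) (f : ℝ → ℝ) (h0 : f (-1) = 0) (hk : f k = 0) :
    ∑ j : Fin k, (CartanMatrix.A k i j : ℝ) * f j = 2 * f i - f (i + 1) - f (i - 1) := by
  have e : ∀ j : Fin k, (CartanMatrix.A k i j : ℝ) * f j =
      (if i = j then 2 * f j else 0) - (if (i : ℕ) + 1 = j then f j else 0)
        - (if (j : ℕ) + 1 = i then f j else 0) := by
    intro j
    simp only [CartanMatrix.A, Matrix.of_apply, Fin.ext_iff]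
    split_ifs <;> first | omega | (push_cast; ring)
  rw [Finset.sum_congr rfl fun j _ => e j, Finset.sum_sub_distrib, Finset.sum_sub_distrib,
    Finset.sum_ite_eq]
  have e1 : ∑ j : Fin k, (if (i : ℕ) + 1 = j then f j else 0) = f (i + 1) := by
    by_cases h : (i : ℕ) + 1 < k
    · rw [Finset.sum_eq_single (⟨(i : ℕ) + 1, h⟩ : Fin k)]
      · simp
      · intro b _ hb
        rw [if_neg]
        intro h'
        exact hb (Fin.ext h'.symm)
      · simp
    · have : ((i : ℕ) : ℝ) + 1 = k := by
        have : (i : ℕ) + 1 = k := by omega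
        exact_mod_cast this
      rw [this, hk]
      refine Finset.sum_eq_zero fun j _ => if_neg (by omega)
  have e2 : ∑ j : Fin k, (if (j : ℕ) + 1 = i then f j else 0) = f (i - 1) := by
    by_cases h : (i : ℕ) = 0
    · rw [h]
      simp [h0]
    · obtain ⟨a, ha⟩ := Nat.exists_eq_succ_of_ne_zero h
      rw [Finset.sum_eq_single (⟨a, by omega⟩ : Fin k)]
      · simp [ha]
      · intro b _ hb
        rw [if_neg]
        intro h'
        exact hb (Fin.ext (by simp only; omega))
      · simp
  rw [e1, e2]
  simp

lemma form_simpleRoot_fundamentalWeight (k : ℕ) (i j : Fin k) :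
    form k (simpleRoot i) (fundamentalWeight j) = if i = j then 1 else 0 := by
  have hk : (k : ℝ) + 1 ≠ 0 := by positivity
  have hj : (j : ℝ) + 1 ≤ k := by exact_mod_cast j.isLt
  have hj0 : (0 : ℝ) ≤ j := Nat.cast_nonneg _
  rw [form_simpleRoot]
  have := sum_cartan k i
    (fun t => min ((j : ℝ) + 1) (t + 1) - ((j : ℝ) + 1) * (t + 1) / ((k : ℝ) + 1))
    (by simp; linarith) (by
      rw [min_eq_left (by linarith)]
      field_simp
      ring)
  unfold fundamentalWeight
  rw [this]
  rcases lt_trichotomy (i : ℕ) j with h | h | h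
  · have h' : (i : ℝ) + 1 ≤ j := by exact_mod_cast h
    rw [if_neg (by intro e; rw [e] at h; omega), min_eq_right (by linarith),
      min_eq_right (by linarith), min_eq_right (by linarith)]
    ring
  · have h' : (i : ℝ) = j := by exact_mod_cast h
    rw [if_pos (Fin.ext h), h', min_eq_right (by linarith),
      min_eq_left (by linarith), min_eq_right (by linarith)]
    ring
  · have h' : (j : ℝ) + 1 ≤ i := by exact_mod_cast h
    rw [if_neg (by intro e; rw [e] at h; omega), min_eq_left (by linarith),
      min_eq_left (by linarith), min_eq_left (by linarith)]
    ring

end KBounded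

/-!
Cores and dominant alcoves are both encoded by windows: increasing sequences `g_0 < ⋯ < g_k` of
integers that represent every residue class modulo `k + 1` once and have the sum `0 + 1 + ⋯ + k`.
The bead set of a `(k+1)`-core is closed under subtraction of `k + 1`, and `g` lists the least
missing bead of each class. On the other side, extend the coordinates of a point `x` of the sum-zero
hyperplane of `ℝ^(k+1)` to `ℤ` by `x_(a+k+1) = x_a - 1`; the alcoves of `C` are the sets on which
these numbers are ordered in the way that some `g` prescribes. The generator `s_i` acts on both by
exchanging `a - 1` and `a` for all `a ≡ i`, so corresponding partitions and alcoves are those with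
the same window.

The alcove of `g` lies in `m A_∅` if and only if `g_k < g_0 + (k + 1) m`. The bounded partition of
`g` has column lengths `∑_a ⌊(g_a - g_c) / (k + 1)⌋` (sum over `a ≥ c`), and comparing these with
the column lengths of a union of `m - 1` rectangles leads to the same inequality. The rotation of
`m A_∅` becomes `g ↦ (g_k - (k + 1) m, g_0, …, g_(k-1)) + m`. Its order is `k + 1`, and it only
shifts residues, so it respects the relation that two windows differ by some `s_i`, which is
adjacency in the Hasse diagram.
-/

namespace KBounded

/-! ### Affine transpositions -/

/-- The affine transposition of `ℤ` exchanging `a - 1` and `a` for all `a` of residue `c` modulo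
`n`. It is a permutation only for `n ≠ 1`. -/
def affSwap {n : ℕ} (c : ZMod n) (a : ℤ) : ℤ :=
  if (a : ZMod n) + 1 = c then a + 1 else if (a : ZMod n) = c then a - 1 else a

section AffSwap

variable {n : ℕ} {c : ZMod n} {a b : ℤ}

lemma affSwap_of_add_one_eq (h : (a : ZMod n) + 1 = c) : affSwap c a = a + 1 := if_pos h

lemma affSwap_of_ne (h : (a : ZMod n) + 1 ≠ c) (h' : (a : ZMod n) ≠ c) : affSwap c a = a := by
  rw [affSwap, if_neg h, if_neg h']

lemma affSwap_add_add (c : ZMod n) (a t : ℤ) :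
    affSwap (c + (t : ZMod n)) (a + t) = affSwap c a + t := by
  simp only [affSwap, Int.cast_add, add_right_comm _ (t : ZMod n) 1, add_left_inj]
  split_ifs <;> ring

lemma affSwap_add_of_cast_eq_zero (c : ZMod n) (a : ℤ) {t : ℤ} (ht : (t : ZMod n) = 0) :
    affSwap c (a + t) = affSwap c a + t := by
  simpa only [ht, add_zero] using affSwap_add_add c a t

variable [Nontrivial (ZMod n)]

lemma affSwap_of_eq (h : (a : ZMod n) = c) : affSwap c a = a - 1 := by
  rw [affSwap, if_neg (by simp [← h]), if_pos h]

lemma affSwap_involutive (c : ZMod n) : Function.Involutive (affSwap c) := by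
  intro a
  by_cases h : (a : ZMod n) + 1 = c
  · rw [affSwap_of_add_one_eq h, affSwap_of_eq (by simpa using h), add_sub_cancel_right]
  by_cases h' : (a : ZMod n) = c
  · rw [affSwap_of_eq h', affSwap_of_add_one_eq (by simpa using h'), sub_add_cancel]
  · rw [affSwap_of_ne h h', affSwap_of_ne h h']

lemma affSwap_lt_affSwap (hab : a < b) (h : b = a + 1 → (b : ZMod n) ≠ c) :
    affSwap c a < affSwap c b := by
  have adjacent : b = a + 1 → ((a : ZMod n) + 1 ≠ c ∧ (b : ZMod n) ≠ c) := by
    rintro rfl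
    exact ⟨by simpa using h rfl, h rfl⟩
  have distance_two : b = a + 2 → (a : ZMod n) + 1 = c → (b : ZMod n) ≠ c := by
    rintro rfl rfl
    push_cast
    grind [one_ne_zero (α := ZMod n)]
  simp only [affSwap]
  split_ifs <;> grind

/-- `affSwap` as a permutation of `ℤ`. -/
def affSwapPerm (c : ZMod n) : Equiv.Perm ℤ := (affSwap_involutive c).toPerm

lemma affSwapPerm_apply (c : ZMod n) (a : ℤ) : affSwapPerm c a = affSwap c a := rfl

end AffSwap

instance (k : ℕ) [NeZero k] : Nontrivial (ZMod (k + 1)) :=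
  (CharP.nontrivial_of_char_ne_one (R := ZMod (k + 1)) (by simp [NeZero.ne k]))

/-! ### Windows -/

/-- The entries of `g` represent each residue class modulo `k + 1` exactly once. -/
def IsResidueSystem {k : ℕ} (g : Fin (k + 1) → ℤ) : Prop :=
  Function.Bijective fun i => (g i : ZMod (k + 1))

/-- The windows `(g 0, …, g k)` of the affine permutations of `ℤ` that are of minimal length in
their coset modulo permutations of the window. They index the alcoves in the dominant chamber. -/
structure IsWindow {k : ℕ} (g : Fin (k + 1) → ℤ) : Prop where
  strictMono : StrictMono g
  residue : IsResidueSystem g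
  sum : ∑ i, g i = ∑ i : Fin (k + 1), ((i : ℕ) : ℤ)

section Window

variable {k : ℕ} {g : Fin (k + 1) → ℤ}

lemma eq_zero_of_cast_eq_zero_of_abs_lt {a : ℤ} (h : (a : ZMod (k + 1)) = 0)
    (ha : |a| < k + 1) : a = 0 := by
  rw [ZMod.intCast_zmod_eq_zero_iff_dvd] at h
  exact Int.eq_zero_of_abs_lt_dvd h (by exact_mod_cast ha)

lemma cast_eq_cast_iff_exists {a b : ℤ} :
    (a : ZMod (k + 1)) = b ↔ ∃ t : ℤ, a = b + (k + 1) * t := by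
  rw [eq_comm, ZMod.intCast_eq_intCast_iff_dvd_sub]
  simp only [Dvd.dvd, Nat.cast_add, Nat.cast_one, sub_eq_iff_eq_add']

lemma cast_period_mul (t : ℤ) : (((k + 1) * t : ℤ) : ZMod (k + 1)) = 0 := by
  have : ((k : ZMod (k + 1)) + 1) = 0 := by exact_mod_cast ZMod.natCast_self (k + 1)
  push_cast
  rw [this, zero_mul]

lemma affSwap_add_mul (c : ZMod (k + 1)) (a t : ℤ) :
    affSwap c (a + (k + 1) * t) = affSwap c a + (k + 1) * t :=
  affSwap_add_of_cast_eq_zero c a (cast_period_mul t)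

lemma isResidueSystem_iff_injective :
    IsResidueSystem g ↔ Function.Injective fun i => (g i : ZMod (k + 1)) := by
  rw [IsResidueSystem, Fintype.bijective_iff_injective_and_card]
  simp only [Fintype.card_fin, ZMod.card, and_true]

lemma IsResidueSystem.eq_of_cast_eq (hg : IsResidueSystem g) {i j : Fin (k + 1)}
    (h : (g i : ZMod (k + 1)) = g j) : i = j :=
  hg.injective h

lemma IsResidueSystem.exists_cast_eq (hg : IsResidueSystem g) (c : ZMod (k + 1)) :
    ∃ i, (g i : ZMod (k + 1)) = c :=
  hg.surjective c

lemma isResidueSystem_id : IsResidueSystem fun i : Fin (k + 1) => ((i : ℕ) : ℤ) := by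
  refine isResidueSystem_iff_injective.mpr fun i j hij => Fin.ext ?_
  have := eq_zero_of_cast_eq_zero_of_abs_lt (k := k) (a := ((i : ℕ) : ℤ) - (j : ℕ))
    (by rw [Int.cast_sub]; exact sub_eq_zero.mpr hij) (by rw [abs_lt]; omega)
  omega

lemma exists_natCast_eq (c : ZMod (k + 1)) : ∃ i : Fin (k + 1), ((i : ℕ) : ZMod (k + 1)) = c := by
  simpa only [Int.cast_natCast] using isResidueSystem_id.exists_cast_eq c

lemma isWindow_id : IsWindow fun i : Fin (k + 1) => ((i : ℕ) : ℤ) where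
  strictMono _ _ hij := Int.ofNat_lt.mpr hij
  residue := isResidueSystem_id
  sum := rfl

lemma IsWindow.eq_id_of_eq_add (hg : IsWindow g) (h : ∀ i, g i = g 0 + (i : ℕ)) :
    g = fun i : Fin (k + 1) => ((i : ℕ) : ℤ) := by
  have sum_eq := hg.sum
  rw [Finset.sum_congr rfl fun i _ => h i, Finset.sum_add_distrib, add_eq_right] at sum_eq
  have zero : g 0 = 0 := by simpa [Nat.cast_add_one_ne_zero] using sum_eq
  funext i
  rw [h, zero, zero_add]

lemma IsWindow.eq_id_of_forall_le_add_one (hg : IsWindow g)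
    (h : ∀ i j, (g j : ZMod (k + 1)) = g i + 1 → g j ≤ g i + 1) :
    g = fun i : Fin (k + 1) => ((i : ℕ) : ℤ) := by
  have exists_entry : ∀ t : ℕ, t ≤ k → ∃ i, g i = g 0 + t := by
    intro t
    induction t with
    | zero => exact fun _ => ⟨0, by simp⟩
    | succ t ih =>
      intro ht
      obtain ⟨i, hi⟩ := ih (by omega)
      obtain ⟨j, hj⟩ := hg.residue.exists_cast_eq ((g i : ZMod (k + 1)) + 1)
      have le_next := h i j hj
      have le_entry : g 0 ≤ g j := hg.strictMono.monotone (Fin.zero_le j)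
      have := eq_zero_of_cast_eq_zero_of_abs_lt (k := k) (a := g j - (g i + 1))
        (by push_cast; rw [hj, sub_self]) (by rw [abs_lt]; omega)
      exact ⟨j, by push_cast; omega⟩
  choose f hf using fun t : Fin (k + 1) => exists_entry t (by omega)
  have f_strictMono : StrictMono f := fun s t hst => by
    rw [← hg.strictMono.lt_iff_lt, hf, hf]
    exact add_lt_add_right (Int.ofNat_lt.mpr hst) _
  have f_eq_id : f = id := (f_strictMono.range_inj strictMono_id).mp <| by
    rw [Set.range_id, (Finite.surjective_of_injective f_strictMono.injective).range_eq]
  exact hg.eq_id_of_eq_add fun i => by rw [← hf i, f_eq_id, id]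

variable [NeZero k]

lemma IsResidueSystem.affSwap_comp (hg : IsResidueSystem g) (c : ZMod (k + 1)) :
    IsResidueSystem fun i => affSwap c (g i) := by
  refine isResidueSystem_iff_injective.mpr fun i j hij => hg.eq_of_cast_eq ?_
  obtain ⟨t, ht⟩ := cast_eq_cast_iff_exists.mp hij
  refine cast_eq_cast_iff_exists.mpr ⟨t, (affSwap_involutive c).injective ?_⟩
  rw [ht, affSwap_add_mul]

lemma IsResidueSystem.sum_affSwap (hg : IsResidueSystem g) (c : ZMod (k + 1)) :
    ∑ i, affSwap c (g i) = ∑ i, g i := by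
  obtain ⟨a, ha⟩ := hg.exists_cast_eq (c - 1)
  obtain ⟨b, rfl⟩ := hg.exists_cast_eq c
  have eq_a (i) : (g i : ZMod (k + 1)) + 1 = g b ↔ i = a :=
    ⟨fun h => hg.eq_of_cast_eq (by rw [ha, ← h, add_sub_cancel_right]),
      fun h => by rw [h, ha, sub_add_cancel]⟩
  have eq_b (i) : (g i : ZMod (k + 1)) = g b ↔ i = b :=
    ⟨hg.eq_of_cast_eq, fun h => by rw [h]⟩
  have a_ne_b : a ≠ b := by
    rintro rfl
    exact one_ne_zero (sub_eq_self.mp ha.symm)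
  have affSwap_eq (i) : affSwap (g b : ZMod (k + 1)) (g i) =
      g i + (if i = a then 1 else 0) - (if i = b then 1 else 0) := by
    simp only [affSwap, eq_a, eq_b]
    split_ifs <;> grind
  rw [Finset.sum_congr rfl fun i _ => affSwap_eq i, Finset.sum_sub_distrib, Finset.sum_add_distrib]
  simp

lemma IsWindow.affSwap_comp (hg : IsWindow g) {c : ZMod (k + 1)}
    (h : ∀ i j, g j = g i + 1 → (g j : ZMod (k + 1)) ≠ c) :
    IsWindow fun i => affSwap c (g i) where
  strictMono i j hij := affSwap_lt_affSwap (hg.strictMono hij) (h i j)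
  residue := hg.residue.affSwap_comp c
  sum := (hg.residue.sum_affSwap c).trans hg.sum

lemma IsResidueSystem.range_affSwap_eq (hg : IsResidueSystem g) {i j : Fin (k + 1)}
    (hij : g j = g i + 1) :
    Set.range (fun a => affSwap (g j : ZMod (k + 1)) (g a)) = Set.range g := by
  have affSwap_i : affSwap (g j : ZMod (k + 1)) (g i) = g j := by
    rw [affSwap_of_add_one_eq (by simp [hij]), hij]
  have affSwap_j : affSwap (g j : ZMod (k + 1)) (g j) = g i := by
    rw [affSwap_of_eq rfl, hij, add_sub_cancel_right]
  have : (fun a => affSwap (g j : ZMod (k + 1)) (g a)) = g ∘ Equiv.swap i j := by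
    funext a
    rcases eq_or_ne a i with rfl | hai
    · simp [affSwap_i]
    rcases eq_or_ne a j with rfl | haj
    · simp [affSwap_j]
    rw [Function.comp_apply, Equiv.swap_apply_of_ne_of_ne hai haj, affSwap_of_ne]
    · exact fun h => hai (hg.eq_of_cast_eq (by simpa [hij] using h))
    · exact fun h => haj (hg.eq_of_cast_eq h)
  rw [this, EquivLike.range_comp]

lemma IsWindow.affSwap_comp_or_range_eq (hg : IsWindow g) (c : ZMod (k + 1)) :
    IsWindow (fun i => affSwap c (g i)) ∨
      Set.range (fun i => affSwap c (g i)) = Set.range g := by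
  by_cases h : ∀ i j, g j = g i + 1 → (g j : ZMod (k + 1)) ≠ c
  · exact Or.inl (hg.affSwap_comp h)
  · push Not at h
    obtain ⟨i, j, hij, rfl⟩ := h
    exact Or.inr (hg.residue.range_affSwap_eq hij)

end Window

/-! ### Words -/

section Word

variable {k : ℕ} [NeZero k]

/-- The affine permutation `s_{i_1} ⋯ s_{i_r}` of `ℤ` for the word `l = [i_1, …, i_r]`. -/
def wordPerm (l : List (Fin (k + 1))) : Equiv.Perm ℤ :=
  (l.map fun i => affSwapPerm ((i : ℕ) : ZMod (k + 1))).prod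

/-- The window of the affine permutation given by a word. -/
def wordWindow (l : List (Fin (k + 1))) (j : Fin (k + 1)) : ℤ := wordPerm l ((j : ℕ) : ℤ)

lemma wordPerm_cons (i : Fin (k + 1)) (l : List (Fin (k + 1))) (a : ℤ) :
    wordPerm (i :: l) a = affSwap ((i : ℕ) : ZMod (k + 1)) (wordPerm l a) :=
  rfl

lemma wordPerm_add_mul (l : List (Fin (k + 1))) (a t : ℤ) :
    wordPerm l (a + (k + 1) * t) = wordPerm l a + (k + 1) * t := by
  induction l with
  | nil => simp [wordPerm]
  | cons i l ih => rw [wordPerm_cons, wordPerm_cons, ih, affSwap_add_mul]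

lemma isResidueSystem_wordWindow (l : List (Fin (k + 1))) : IsResidueSystem (wordWindow l) := by
  induction l with
  | nil => exact isResidueSystem_id
  | cons i l ih => exact ih.affSwap_comp ((i : ℕ) : ZMod (k + 1))

lemma sum_wordWindow (l : List (Fin (k + 1))) :
    ∑ j, wordWindow l j = ∑ j : Fin (k + 1), ((j : ℕ) : ℤ) := by
  induction l with
  | nil => rfl
  | cons i l ih => exact ((isResidueSystem_wordWindow l).sum_affSwap _).trans ih

lemma exists_wordWindow_cons_eq (c : ZMod (k + 1)) (l : List (Fin (k + 1))) :
    ∃ i, wordWindow (i :: l) = fun j => affSwap c (wordWindow l j) := by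
  obtain ⟨i, rfl⟩ := exists_natCast_eq c
  exact ⟨i, rfl⟩

lemma IsResidueSystem.sum_sq_affSwap_lt {g : Fin (k + 1) → ℤ} (hg : IsResidueSystem g)
    {a b : Fin (k + 1)} (hab : (g b : ZMod (k + 1)) = g a + 1) (hlt : g a + 1 < g b) :
    ∑ i, affSwap (g b : ZMod (k + 1)) (g i) ^ 2 < ∑ i, g i ^ 2 := by
  have b_ne_a : b ≠ a := by rintro rfl; omega
  have b_mem : b ∈ Finset.univ.erase a := by simp [b_ne_a]
  have affSwap_other : ∀ i ∈ (Finset.univ.erase a).erase b,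
      affSwap (g b : ZMod (k + 1)) (g i) ^ 2 = g i ^ 2 := by
    intro i hi
    simp only [Finset.mem_erase] at hi
    rw [affSwap_of_ne]
    · exact fun h => hi.2.1 (hg.eq_of_cast_eq (add_right_cancel (h.trans hab)))
    · exact fun h => hi.1 (hg.eq_of_cast_eq h)
  simp only [← Finset.add_sum_erase _ _ (Finset.mem_univ a), ← Finset.add_sum_erase _ _ b_mem]
  rw [Finset.sum_congr rfl affSwap_other, affSwap_of_add_one_eq hab.symm, affSwap_of_eq rfl]
  nlinarith

lemma IsWindow.exists_word {g : Fin (k + 1) → ℤ} (hg : IsWindow g) :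
    ∃ l : List (Fin (k + 1)), wordWindow l = g := by
  induction hN : (∑ i, g i ^ 2).toNat using Nat.strong_induction_on generalizing g with
  | _ N ih =>
  by_cases h : ∀ i j, (g j : ZMod (k + 1)) = g i + 1 → g j ≤ g i + 1
  · exact ⟨[], (hg.eq_id_of_forall_le_add_one h).symm⟩
  push Not at h
  obtain ⟨a, b, hab, hlt⟩ := h
  have isWindow_swap : IsWindow fun i => affSwap (g b : ZMod (k + 1)) (g i) := by
    refine hg.affSwap_comp fun i j hij hj => ?_
    obtain rfl := hg.residue.eq_of_cast_eq hj
    obtain rfl : i = a := hg.residue.eq_of_cast_eq (by simpa [hij] using hab)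
    omega
  have sum_lt := hg.residue.sum_sq_affSwap_lt hab hlt
  have sum_nonneg : 0 ≤ ∑ i, affSwap (g b : ZMod (k + 1)) (g i) ^ 2 :=
    Finset.sum_nonneg fun i _ => sq_nonneg _
  obtain ⟨l, hl⟩ := ih _ (by omega) isWindow_swap rfl
  obtain ⟨i, hi⟩ := exists_wordWindow_cons_eq (g b : ZMod (k + 1)) l
  refine ⟨i :: l, funext fun j => ?_⟩
  rw [hi, hl]
  exact affSwap_involutive _ _

end Word

/-! ### Partitions and their beads -/

section YoungDiagram

lemma lt_colLen_iff_lt_rowLen (mu : YoungDiagram) {r c : ℕ} :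
    r < mu.colLen c ↔ c < mu.rowLen r := by
  rw [← YoungDiagram.mem_iff_lt_colLen, YoungDiagram.mem_iff_lt_rowLen]

lemma eq_of_rowLen_eq {mu nu : YoungDiagram} (h : ∀ r, mu.rowLen r = nu.rowLen r) : mu = nu := by
  ext ⟨r, c⟩
  simp only [YoungDiagram.mem_cells, YoungDiagram.mem_iff_lt_rowLen, h]

lemma rowLen_eq_zero_of_le {mu : YoungDiagram} {r : ℕ} (h : mu.colLen 0 ≤ r) :
    mu.rowLen r = 0 := by
  rwa [← not_lt, lt_colLen_iff_lt_rowLen, not_lt, Nat.le_zero] at h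

lemma rowLen_bot (r : ℕ) : (⊥ : YoungDiagram).rowLen r = 0 :=
  Nat.eq_zero_of_not_pos fun h =>
    YoungDiagram.notMem_bot (r, 0) (YoungDiagram.mem_iff_lt_rowLen.mpr h)

lemma colLen_zero_ne_zero {mu : YoungDiagram} (h : mu ≠ ⊥) : mu.colLen 0 ≠ 0 := fun h0 =>
  h <| eq_of_rowLen_eq fun r => by rw [rowLen_bot, rowLen_eq_zero_of_le (h0.trans_le r.zero_le)]

lemma exists_rowLen_eq {f : ℕ → ℕ} (hf : Antitone f) {N : ℕ} (hN : f N = 0) :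
    ∃ mu : YoungDiagram, ∀ r, mu.rowLen r = f r := by
  let mu : YoungDiagram :=
    { cells := (Finset.range N ×ˢ Finset.range (f 0)).filter fun x => x.2 < f x.1
      isLowerSet := by
        rintro ⟨a, b⟩ ⟨c, d⟩ ⟨hca, hdb⟩ h
        simp only [Finset.coe_filter, Finset.mem_product, Finset.mem_range,
          Set.mem_ofPred_eq] at h hca hdb ⊢
        have := hf hca
        omega }
  refine ⟨mu, fun r => eq_of_forall_lt_iff fun c => ?_⟩
  rw [← YoungDiagram.mem_iff_lt_rowLen, ← YoungDiagram.mem_cells]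
  simp only [mu, Finset.mem_filter, Finset.mem_product, Finset.mem_range]
  refine ⟨fun h => h.2, fun h => ⟨⟨?_, h.trans_le (hf r.zero_le)⟩, h⟩⟩
  by_contra! hr
  have := hf hr
  omega

end YoungDiagram

section Bead

/-- The beads of `mu`: `bead mu r` is the content of the last cell in row `r`, or `-r-1` if the
row is empty. -/
def bead (mu : YoungDiagram) (r : ℕ) : ℤ := (mu.rowLen r : ℤ) - r - 1

/-- The set of all beads of `mu`. -/
def beadSet (mu : YoungDiagram) : Set ℤ := Set.range (bead mu)

variable {mu nu : YoungDiagram}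

lemma bead_strictAnti (mu : YoungDiagram) : StrictAnti (bead mu) := by
  intro r s h
  have := mu.rowLen_anti r s h.le
  unfold bead
  omega

lemma bead_mem (mu : YoungDiagram) (r : ℕ) : bead mu r ∈ beadSet mu := ⟨r, rfl⟩

lemma eq_of_bead_eq (h : bead mu = bead nu) : mu = nu := by
  refine eq_of_rowLen_eq fun r => ?_
  have := congrFun h r
  unfold bead at this
  omega

lemma eq_of_beadSet_eq (h : beadSet mu = beadSet nu) : mu = nu :=
  eq_of_bead_eq <| OrderDual.toDual.injective.comp_left <|
    (StrictMono.range_inj (bead_strictAnti mu).dual_right (bead_strictAnti nu).dual_right).mp h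

lemma beadSet_bot : beadSet ⊥ = {a : ℤ | a < 0} := by
  ext a
  simp only [beadSet, bead, rowLen_bot, Set.mem_range, Set.mem_ofPred_eq]
  exact ⟨by rintro ⟨r, rfl⟩; omega, fun ha => ⟨(-a - 1).toNat, by omega⟩⟩

lemma bead_add_one_notMem_iff {r : ℕ} :
    bead mu r + 1 ∉ beadSet mu ↔ ∀ s < r, mu.rowLen r < mu.rowLen s := by
  constructor
  · intro h s hs
    by_contra! hle
    have le_prev := mu.rowLen_anti s (r - 1) (by omega)
    have ge_prev := mu.rowLen_anti (r - 1) r (by omega)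
    exact h ⟨r - 1, by unfold bead; omega⟩
  · rintro h ⟨s, hs⟩
    have hsr := (bead_strictAnti mu).lt_iff_gt.mp (by omega : bead mu r < bead mu s)
    have := h s hsr
    unfold bead at hs
    omega

lemma bead_sub_one_notMem_iff {r : ℕ} :
    bead mu r - 1 ∉ beadSet mu ↔ ∀ s > r, mu.rowLen s < mu.rowLen r := by
  constructor
  · intro h s hs
    by_contra! hle
    have le_next := mu.rowLen_anti (r + 1) s hs
    have ge_next := mu.rowLen_anti r (r + 1) (by omega)
    exact h ⟨r + 1, by unfold bead; omega⟩
  · rintro h ⟨s, hs⟩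
    have hsr := (bead_strictAnti mu).lt_iff_gt.mp (by omega : bead mu s < bead mu r)
    have := h s hsr
    unfold bead at hs
    omega

lemma isAddable_iff {r c : ℕ} :
    IsAddable mu (r, c) ↔ c = mu.rowLen r ∧ ∀ s < r, mu.rowLen r < mu.rowLen s := by
  have mem_insert (x : ℕ × ℕ) : x ∈ insert (r, c) (mu.cells : Set (ℕ × ℕ)) ↔
      x = (r, c) ∨ x.2 < mu.rowLen x.1 := by
    rw [Set.mem_insert_iff, Finset.mem_coe, YoungDiagram.mem_cells,
      ← YoungDiagram.mem_iff_lt_rowLen]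
  rw [IsAddable, YoungDiagram.mem_iff_lt_rowLen]
  constructor
  · rintro ⟨notMem, lower⟩
    have mem_of_le (s d) (hs : s ≤ r) (hd : d ≤ c) : (s, d) = (r, c) ∨ d < mu.rowLen s :=
      (mem_insert (s, d)).mp (lower (Prod.mk_le_mk.mpr ⟨hs, hd⟩) (Set.mem_insert _ _))
    have := mem_of_le r (mu.rowLen r) le_rfl (not_lt.mp notMem)
    have hc : c = mu.rowLen r := by grind
    exact ⟨hc, fun s hs => by have := mem_of_le s c hs.le le_rfl; grind⟩
  · rintro ⟨rfl, h⟩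
    refine ⟨lt_irrefl _, fun x y hyx hx => ?_⟩
    rw [mem_insert] at hx ⊢
    obtain rfl | hx := hx
    · have := h y.1
      grind [Prod.le_def]
    · exact Or.inr ((hyx.2.trans_lt hx).trans_le (mu.rowLen_anti _ _ hyx.1))

lemma isRemovable_iff {r c : ℕ} :
    IsRemovable mu (r, c) ↔ c + 1 = mu.rowLen r ∧ ∀ s > r, mu.rowLen s < mu.rowLen r := by
  have mem_diff (x : ℕ × ℕ) : x ∈ (mu.cells : Set (ℕ × ℕ)) \ {(r, c)} ↔
      x.2 < mu.rowLen x.1 ∧ x ≠ (r, c) := by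
    rw [Set.mem_sdiff_singleton, Finset.mem_coe, YoungDiagram.mem_cells,
      ← YoungDiagram.mem_iff_lt_rowLen]
  rw [IsRemovable, YoungDiagram.mem_iff_lt_rowLen]
  constructor
  · rintro ⟨mem, lower⟩
    have le_of_ge (s d) (hs : r ≤ s) (hd : c ≤ d) (hne : (s, d) ≠ (r, c)) : mu.rowLen s ≤ d := by
      by_contra! hlt
      exact (lower (Prod.mk_le_mk.mpr ⟨hs, hd⟩) ((mem_diff (s, d)).mpr ⟨hlt, hne⟩)).2 rfl
    have := le_of_ge r (c + 1) le_rfl c.le_succ (by simp)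
    refine ⟨by omega, fun s hs => ?_⟩
    have := le_of_ge s c (le_of_lt hs) le_rfl (by grind)
    omega
  · rintro ⟨hc, h⟩
    refine ⟨by omega, fun x y hyx hx => ?_⟩
    rw [mem_diff] at hx ⊢
    refine ⟨(hyx.2.trans_lt hx.1).trans_le (mu.rowLen_anti _ _ hyx.1), ?_⟩
    rintro rfl
    have := h x.1
    grind [Prod.le_def]

end Bead

/-! ### The action on cores in terms of beads -/

section BeadClosed

variable {k : ℕ} {mu : YoungDiagram} {i : Fin (k + 1)} {b : ℤ}

lemma hasContent_iff {r c : ℕ} :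
    HasContent i (r, c) ↔ (((c : ℤ) - r : ℤ) : ZMod (k + 1)) = (i : ℕ) := by
  rw [HasContent, ← ZMod.intCast_eq_intCast_iff, Int.cast_natCast]

lemma isAddable_and_hasContent_iff {r c : ℕ} :
    IsAddable mu (r, c) ∧ HasContent i (r, c) ↔ c = mu.rowLen r ∧
      (bead mu r : ZMod (k + 1)) + 1 = (i : ℕ) ∧ bead mu r + 1 ∉ beadSet mu := by
  rw [isAddable_iff, ← bead_add_one_notMem_iff, hasContent_iff, and_assoc]
  refine and_congr_right fun hc => ?_
  rw [and_comm, show (c : ℤ) - r = bead mu r + 1 by unfold bead; omega, Int.cast_add, Int.cast_one]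

lemma isRemovable_and_hasContent_iff {r c : ℕ} :
    IsRemovable mu (r, c) ∧ HasContent i (r, c) ↔ c + 1 = mu.rowLen r ∧
      (bead mu r : ZMod (k + 1)) = (i : ℕ) ∧ bead mu r - 1 ∉ beadSet mu := by
  rw [isRemovable_iff, ← bead_sub_one_notMem_iff, hasContent_iff, and_assoc]
  refine and_congr_right fun hc => ?_
  rw [and_comm, show (c : ℤ) - r = bead mu r by unfold bead; omega]

lemma exists_isAddable_iff :
    (∃ x, IsAddable mu x ∧ HasContent i x) ↔
      ∃ b ∈ beadSet mu, (b : ZMod (k + 1)) + 1 = (i : ℕ) ∧ b + 1 ∉ beadSet mu := by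
  simp only [Prod.exists, isAddable_and_hasContent_iff, exists_eq_left, beadSet,
    Set.exists_range_iff]

open Classical in
lemma bead_addCells (r : ℕ) : bead (addCells i mu) r =
    if (bead mu r : ZMod (k + 1)) + 1 = (i : ℕ) ∧ bead mu r + 1 ∉ beadSet mu then bead mu r + 1
    else bead mu r := by
  have lt_rowLen_iff (c) : c < (addCells i mu).rowLen r ↔ c < mu.rowLen r ∨ c = mu.rowLen r ∧
      (bead mu r : ZMod (k + 1)) + 1 = (i : ℕ) ∧ bead mu r + 1 ∉ beadSet mu := by
    rw [← YoungDiagram.mem_iff_lt_rowLen, mem_addCells, YoungDiagram.mem_iff_lt_rowLen,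
      isAddable_and_hasContent_iff]
  split_ifs with h
  · have : (addCells i mu).rowLen r = mu.rowLen r + 1 := eq_of_forall_lt_iff fun c => by
      rw [lt_rowLen_iff, and_iff_left h]
      omega
    unfold bead
    omega
  · have : (addCells i mu).rowLen r = mu.rowLen r := eq_of_forall_lt_iff fun c => by
      rw [lt_rowLen_iff]
      tauto
    rw [bead, bead, this]

open Classical in
lemma bead_removeCells (r : ℕ) : bead (removeCells i mu) r =
    if (bead mu r : ZMod (k + 1)) = (i : ℕ) ∧ bead mu r - 1 ∉ beadSet mu then bead mu r - 1
    else bead mu r := by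
  have lt_rowLen_iff (c) : c < (removeCells i mu).rowLen r ↔ c < mu.rowLen r ∧
      ¬ (c + 1 = mu.rowLen r ∧
        (bead mu r : ZMod (k + 1)) = (i : ℕ) ∧ bead mu r - 1 ∉ beadSet mu) := by
    rw [← YoungDiagram.mem_iff_lt_rowLen, mem_removeCells, YoungDiagram.mem_iff_lt_rowLen,
      isRemovable_and_hasContent_iff]
  split_ifs with h
  · have rowLen_lt := bead_sub_one_notMem_iff.mp h.2 (r + 1) r.lt_succ_self
    have : (removeCells i mu).rowLen r = mu.rowLen r - 1 := eq_of_forall_lt_iff fun c => by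
      rw [lt_rowLen_iff, and_iff_left h]
      omega
    unfold bead
    omega
  · have : (removeCells i mu).rowLen r = mu.rowLen r := eq_of_forall_lt_iff fun c => by
      rw [lt_rowLen_iff]
      tauto
    rw [bead, bead, this]

lemma mem_beadSet_addCells_iff : b ∈ beadSet (addCells i mu) ↔
    b ∈ beadSet mu ∧ ((b : ZMod (k + 1)) + 1 = (i : ℕ) → b + 1 ∈ beadSet mu) ∨
      (b : ZMod (k + 1)) = (i : ℕ) ∧ b - 1 ∈ beadSet mu ∧ b ∉ beadSet mu := by
  constructor
  · rintro ⟨r, rfl⟩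
    rw [bead_addCells]
    split_ifs with h
    · exact Or.inr ⟨by simpa using h.1, by simp [bead_mem], h.2⟩
    · exact Or.inl ⟨bead_mem mu r, by tauto⟩
  · rintro (⟨⟨r, rfl⟩, h⟩ | ⟨hb, ⟨r, hr⟩, h⟩)
    · exact ⟨r, by rw [bead_addCells, if_neg (by tauto)]⟩
    · obtain rfl : b = bead mu r + 1 := by omega
      exact ⟨r, by rw [bead_addCells, if_pos ⟨by simpa using hb, h⟩]⟩

lemma mem_beadSet_removeCells_iff : b ∈ beadSet (removeCells i mu) ↔
    b ∈ beadSet mu ∧ ((b : ZMod (k + 1)) = (i : ℕ) → b - 1 ∈ beadSet mu) ∨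
      (b : ZMod (k + 1)) + 1 = (i : ℕ) ∧ b + 1 ∈ beadSet mu ∧ b ∉ beadSet mu := by
  constructor
  · rintro ⟨r, rfl⟩
    rw [bead_removeCells]
    split_ifs with h
    · exact Or.inr ⟨by simpa using h.1, by simp [bead_mem], h.2⟩
    · exact Or.inl ⟨bead_mem mu r, by tauto⟩
  · rintro (⟨⟨r, rfl⟩, h⟩ | ⟨hb, ⟨r, hr⟩, h⟩)
    · exact ⟨r, by rw [bead_removeCells, if_neg (by tauto)]⟩
    · obtain rfl : b = bead mu r - 1 := by omega
      exact ⟨r, by rw [bead_removeCells, if_pos ⟨by simpa using hb, h⟩]⟩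

/-- The bead set of `mu` is closed under subtraction of `k + 1`; these `mu` are the
`(k+1)`-cores. -/
def BeadClosed (k : ℕ) (mu : YoungDiagram) : Prop :=
  ∀ b ∈ beadSet mu, b - (k + 1) ∈ beadSet mu

lemma beadClosed_bot : BeadClosed k ⊥ := by
  simp only [BeadClosed, beadSet_bot, Set.mem_ofPred_eq]
  omega

lemma BeadClosed.sub_mul_mem (h : BeadClosed k mu) (hb : b ∈ beadSet mu) (t : ℕ) :
    b - (k + 1) * t ∈ beadSet mu := by
  induction t with
  | zero => simpa using hb
  | succ t ih =>
    rw [Nat.cast_succ, mul_add, mul_one, ← sub_sub]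
    exact h _ ih

lemma BeadClosed.mem_of_le (h : BeadClosed k mu) {a : ℤ} (hb : b ∈ beadSet mu)
    (hab : (b : ZMod (k + 1)) = a) (hle : a ≤ b) : a ∈ beadSet mu := by
  obtain ⟨t, rfl⟩ := cast_eq_cast_iff_exists.mp hab
  lift t to ℕ using nonneg_of_mul_nonneg_right (by linarith : 0 ≤ ((k : ℤ) + 1) * t) (by omega)
  simpa using h.sub_mul_mem hb t

lemma BeadClosed.sub_one_mem (h : BeadClosed k mu) {c : ℤ} (hb : b ∈ beadSet mu)
    (hb_succ : b + 1 ∉ beadSet mu) (hc : c ∈ beadSet mu)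
    (hcb : (c : ZMod (k + 1)) = b + 1) : c - 1 ∈ beadSet mu := by
  rcases lt_or_ge b c with hlt | hle
  · exact absurd (h.mem_of_le hc (by simpa using hcb) hlt) hb_succ
  · exact h.mem_of_le hb (by simp [hcb]) (by omega)

lemma BeadClosed.exists_card_coreAct_lt (h : BeadClosed k mu) (hmu : mu ≠ ⊥) :
    ∃ i : Fin (k + 1), (coreAct i mu).card < mu.card := by
  obtain ⟨r, hr⟩ := Nat.exists_eq_succ_of_ne_zero (colLen_zero_ne_zero hmu)
  have rowLen_pos : 0 < mu.rowLen r := (lt_colLen_iff_lt_rowLen mu).mp (by omega)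
  have bead_sub_one_notMem : bead mu r - 1 ∉ beadSet mu :=
    bead_sub_one_notMem_iff.mpr fun s hs => by rwa [rowLen_eq_zero_of_le (by omega)]
  obtain ⟨i, hi⟩ := exists_natCast_eq (bead mu r : ZMod (k + 1))
  have not_addable : ¬ ∃ x, IsAddable mu x ∧ HasContent i x := by
    rw [exists_isAddable_iff]
    rintro ⟨b, hb, hbi, hb_succ⟩
    exact bead_sub_one_notMem (h.sub_one_mem hb hb_succ (bead_mem mu r) (hi.symm.trans hbi.symm))
  have removable : IsRemovable mu (r, mu.rowLen r - 1) ∧ HasContent i (r, mu.rowLen r - 1) :=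
    isRemovable_and_hasContent_iff.mpr ⟨by omega, hi.symm, bead_sub_one_notMem⟩
  refine ⟨i, Finset.card_lt_card ?_⟩
  rw [coreAct, if_neg not_addable]
  classical
  refine Finset.filter_ssubset.mpr ⟨_, removable.1.1, not_not_intro removable⟩

variable [NeZero k]

lemma BeadClosed.beadSet_coreAct (h : BeadClosed k mu) (i : Fin (k + 1)) :
    beadSet (coreAct i mu) = affSwapPerm ((i : ℕ) : ZMod (k + 1)) '' beadSet mu := by
  ext b
  rw [Equiv.image_eq_preimage_symm, Set.mem_preimage]
  change _ ↔ affSwap _ b ∈ beadSet mu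
  unfold KBounded.coreAct
  have residue_ne {a : ℤ} (ha : (a : ZMod (k + 1)) + 1 = (i : ℕ)) :
      (a : ZMod (k + 1)) ≠ (i : ℕ) := fun h => by simp [h] at ha
  split_ifs with hadd <;> rw [exists_isAddable_iff] at hadd
  · obtain ⟨a, ha, hai, ha_succ⟩ := hadd
    have sub_one_mem {c : ℤ} (hci : (c : ZMod (k + 1)) = (i : ℕ)) (hc : c ∈ beadSet mu) :
        c - 1 ∈ beadSet mu := h.sub_one_mem ha ha_succ hc (hci.trans hai.symm)
    rw [mem_beadSet_addCells_iff, affSwap]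
    split_ifs with hb hb'
    · have := sub_one_mem (c := b + 1) (by simpa using hb)
      grind [residue_ne hb]
    · grind [sub_one_mem hb']
    · grind
  · push Not at hadd
    rw [mem_beadSet_removeCells_iff, affSwap]
    split_ifs with hb hb'
    · grind [residue_ne hb]
    · have := hadd (b - 1)
      grind [Int.cast_sub, Int.cast_one]
    · grind

lemma BeadClosed.coreAct (h : BeadClosed k mu) (i : Fin (k + 1)) :
    BeadClosed k (coreAct i mu) := by
  intro b hb
  rw [h.beadSet_coreAct] at hb ⊢
  obtain ⟨a, ha, rfl⟩ := hb
  refine ⟨a - (k + 1), h a ha, ?_⟩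
  simpa [sub_eq_add_neg, affSwapPerm_apply] using affSwap_add_mul ((i : ℕ) : ZMod (k + 1)) a (-1)

lemma BeadClosed.coreAct_coreAct (h : BeadClosed k mu) (i : Fin (k + 1)) :
    KBounded.coreAct i (KBounded.coreAct i mu) = mu := by
  apply eq_of_beadSet_eq
  rw [(h.coreAct i).beadSet_coreAct, h.beadSet_coreAct, Set.image_image]
  exact (Set.image_congr' (affSwap_involutive _)).trans (Set.image_id' _)

lemma beadClosed_wordCore (l : List (Fin (k + 1))) : BeadClosed k (wordCore l) := by
  induction l with
  | nil => exact beadClosed_bot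
  | cons i l ih => exact ih.coreAct i

lemma BeadClosed.exists_wordCore (h : BeadClosed k mu) :
    ∃ l : List (Fin (k + 1)), wordCore l = mu := by
  induction hN : mu.card using Nat.strong_induction_on generalizing mu with
  | _ N ih =>
  by_cases hmu : mu = ⊥
  · exact ⟨[], hmu.symm⟩
  obtain ⟨i, hi⟩ := h.exists_card_coreAct_lt hmu
  obtain ⟨l, hl⟩ := ih _ (hN ▸ hi) (h.coreAct i) rfl
  exact ⟨i :: l, (congrArg (KBounded.coreAct i) hl).trans (h.coreAct_coreAct i)⟩

end BeadClosed

/-! ### Cores and bounded partitions -/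

section Hook

variable {k : ℕ} {mu lam lam' : YoungDiagram} {r c : ℕ}

lemma hook_add_eq (h : c < mu.rowLen r) :
    hook mu r c + r + c + 1 = mu.rowLen r + mu.colLen c := by
  have := (lt_colLen_iff_lt_rowLen mu).mpr h
  unfold hook
  omega

lemma hook_anti {d : ℕ} (hcd : c ≤ d) (h : d < mu.rowLen r) : hook mu r d ≤ hook mu r c := by
  have hook_d := hook_add_eq h
  have hook_c := hook_add_eq (hcd.trans_lt h)
  have := mu.colLen_anti c d hcd
  omega

lemma exists_hook_lt_iff (mu : YoungDiagram) (r n : ℕ) :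
    ∃ c₀ ≤ mu.rowLen r, ∀ c < mu.rowLen r, hook mu r c < n ↔ c₀ ≤ c := by
  classical
  have exists_col : ∃ c, c < mu.rowLen r → hook mu r c < n :=
    ⟨mu.rowLen r, fun h => absurd h (lt_irrefl _)⟩
  refine ⟨Nat.find exists_col, Nat.find_min' _ fun h => absurd h (lt_irrefl _), fun c hc => ?_⟩
  exact ⟨fun h => Nat.find_min' _ fun _ => h, fun h =>
    (hook_anti h hc).trans_lt (Nat.find_spec exists_col (h.trans_lt hc))⟩

lemma card_filter_hook_lt {c₀ n : ℕ} (h : ∀ c < mu.rowLen r, hook mu r c < n ↔ c₀ ≤ c) :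
    ((Finset.range (mu.rowLen r)).filter fun c => hook mu r c < n).card = mu.rowLen r - c₀ := by
  rw [← Nat.card_Ico]
  congr 1
  ext c
  rw [Finset.mem_filter, Finset.mem_range, Finset.mem_Ico, and_comm]
  exact and_congr_left fun hc => h c hc

lemma IsCoreOf.rowLen_le_and_rowLen_eq (h : IsCoreOf k mu lam) (r : ℕ) : lam.rowLen r ≤ k ∧
    mu.rowLen r = lam.rowLen r + mu.rowLen (r + (k + 1 - lam.rowLen r)) := by
  obtain ⟨c₀, c₀_le, hook_lt_iff⟩ := exists_hook_lt_iff mu r (k + 1)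
  have rowLen_lam : lam.rowLen r = mu.rowLen r - c₀ :=
    (h.2 r).trans (card_filter_hook_lt hook_lt_iff)
  have hook_at : c₀ < mu.rowLen r → mu.rowLen r + mu.colLen c₀ < k + 1 + r + c₀ + 1 := fun hc => by
    have := (hook_lt_iff c₀ hc).mpr le_rfl
    have := hook_add_eq hc
    omega
  have le_k : lam.rowLen r ≤ k := by
    by_contra! hlt
    have hc : c₀ < mu.rowLen r := by omega
    have := hook_at hc
    have := (lt_colLen_iff_lt_rowLen mu).mpr hc
    omega
  suffices mu.rowLen (r + (k + 1 - lam.rowLen r)) = c₀ from ⟨le_k, by omega⟩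
  refine eq_of_forall_lt_iff fun c => ?_
  rw [← lt_colLen_iff_lt_rowLen]
  constructor
  · intro hc
    by_contra! hle
    have := mu.colLen_anti c₀ c hle
    have := (lt_colLen_iff_lt_rowLen mu (r := r) (c := c)).mp (by omega)
    have := hook_at (by omega)
    omega
  · intro hc
    have : c < mu.rowLen r := by omega
    have := mu.colLen_anti c (c₀ - 1) (by omega)
    have := hook_add_eq (mu := mu) (r := r) (c := c₀ - 1) (by omega)
    have := (hook_lt_iff (c₀ - 1) (by omega)).not.mpr (by omega)
    have := h.1 r (c₀ - 1) (YoungDiagram.mem_iff_lt_rowLen.mpr (by omega))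
    omega

lemma hook_lt_iff_and_hook_ne {a : ℕ} (ha : a ≤ k)
    (h : mu.rowLen r = a + mu.rowLen (r + (k + 1 - a))) (hc : c < mu.rowLen r) :
    (hook mu r c < k + 1 ↔ mu.rowLen (r + (k + 1 - a)) ≤ c) ∧ hook mu r c ≠ k + 1 := by
  have hook_eq := hook_add_eq hc
  have lt_iff := lt_colLen_iff_lt_rowLen mu (r := r + (k + 1 - a)) (c := c)
  omega

lemma isCoreOf_iff : IsCoreOf k mu lam ↔ ∀ r, lam.rowLen r ≤ k ∧
    mu.rowLen r = lam.rowLen r + mu.rowLen (r + (k + 1 - lam.rowLen r)) := by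
  refine ⟨IsCoreOf.rowLen_le_and_rowLen_eq, fun h => ⟨fun r c hrc => ?_, fun r => ?_⟩⟩
  · exact (hook_lt_iff_and_hook_ne (h r).1 (h r).2 (YoungDiagram.mem_iff_lt_rowLen.mp hrc)).2
  · rw [card_filter_hook_lt fun c hc => (hook_lt_iff_and_hook_ne (h r).1 (h r).2 hc).1]
    have := h r
    omega

lemma IsCoreOf.isKBounded (h : IsCoreOf k mu lam) : IsKBounded k lam :=
  fun r => (h.rowLen_le_and_rowLen_eq r).1

lemma IsCoreOf.bead_add_eq (h : IsCoreOf k mu lam) (r : ℕ) :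
    bead mu (r + (k + 1 - lam.rowLen r)) = bead mu r - (k + 1) := by
  have := h.rowLen_le_and_rowLen_eq r
  unfold bead
  omega

lemma IsCoreOf.beadClosed (h : IsCoreOf k mu lam) : BeadClosed k mu := by
  rintro _ ⟨r, rfl⟩
  rw [← h.bead_add_eq r]
  exact bead_mem mu _

lemma BeadClosed.exists_isCoreOf (h : BeadClosed k mu) : ∃ lam, IsCoreOf k mu lam := by
  choose t bead_t using fun r => h _ (bead_mem mu r)
  have bead_lt_iff {r s : ℕ} : bead mu r < bead mu s ↔ s < r := (bead_strictAnti mu).lt_iff_gt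
  have lt_t (r) : r < t r := bead_lt_iff.mp (by rw [bead_t]; omega)
  have t_lt_t_succ (r) : t r < t (r + 1) := bead_lt_iff.mp (by
    have : bead mu (r + 1) < bead mu r := bead_lt_iff.mpr r.lt_succ_self
    rw [bead_t, bead_t]
    omega)
  have rowLen_add (r) : mu.rowLen r + t r = k + 1 + mu.rowLen (t r) + r := by
    have := bead_t r
    unfold bead at this
    omega
  have rowLen_t_le (r) : mu.rowLen (t r) ≤ mu.rowLen r := mu.rowLen_anti r (t r) (lt_t r).le
  have antitone : Antitone fun r => mu.rowLen r - mu.rowLen (t r) :=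
    antitone_nat_of_succ_le fun r => by grind
  obtain ⟨lam, hlam⟩ := exists_rowLen_eq antitone (N := mu.colLen 0)
    (by rw [rowLen_eq_zero_of_le le_rfl, Nat.zero_sub])
  refine ⟨lam, isCoreOf_iff.mpr fun r => ?_⟩
  have t_eq : r + (k + 1 - (mu.rowLen r - mu.rowLen (t r))) = t r := by grind
  rw [hlam, t_eq]
  grind

lemma IsCoreOf.core_unique {nu : YoungDiagram} (h : IsCoreOf k mu lam) (h' : IsCoreOf k nu lam) :
    mu = nu := by
  refine eq_of_rowLen_eq fun r => ?_
  induction hN : max (mu.colLen 0) (nu.colLen 0) - r using Nat.strong_induction_on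
    generalizing r with
  | _ N ih =>
  by_cases hr : max (mu.colLen 0) (nu.colLen 0) ≤ r
  · rw [rowLen_eq_zero_of_le (mu := mu) (by omega), rowLen_eq_zero_of_le (mu := nu) (by omega)]
  · have := h.rowLen_le_and_rowLen_eq r
    have := h'.rowLen_le_and_rowLen_eq r
    have := ih _ (by omega) (r + (k + 1 - lam.rowLen r)) rfl
    omega

lemma IsCoreOf.partition_unique (h : IsCoreOf k mu lam) (h' : IsCoreOf k mu lam') : lam = lam' :=
  eq_of_rowLen_eq fun r => (h.2 r).trans (h'.2 r).symm

end Hook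

section CoreRow

variable {k : ℕ} {lam : YoungDiagram}

/-- The row lengths of the `(k+1)`-core of the `k`-bounded partition `lam`. -/
def coreRow (k : ℕ) (lam : YoungDiagram) (r : ℕ) : ℕ :=
  if _h : r < lam.colLen 0 ∧ lam.rowLen r ≤ k then
    lam.rowLen r + coreRow k lam (r + (k + 1 - lam.rowLen r))
  else 0
termination_by lam.colLen 0 - r
decreasing_by omega

lemma coreRow_eq_zero {r : ℕ} (h : lam.colLen 0 ≤ r) : coreRow k lam r = 0 := by
  rw [coreRow, dif_neg (by omega)]

lemma IsKBounded.coreRow_eq (h : IsKBounded k lam) (r : ℕ) :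
    coreRow k lam r = lam.rowLen r + coreRow k lam (r + (k + 1 - lam.rowLen r)) := by
  by_cases hr : r < lam.colLen 0
  · rw [coreRow, dif_pos ⟨hr, h r⟩]
  · rw [coreRow_eq_zero (by omega), coreRow_eq_zero (by omega), rowLen_eq_zero_of_le (by omega)]

lemma IsKBounded.coreRow_antitone (h : IsKBounded k lam) : Antitone (coreRow k lam) := by
  intro r s hrs
  induction hN : lam.colLen 0 - r using Nat.strong_induction_on generalizing r s with
  | _ N ih =>
  by_cases hs : lam.colLen 0 ≤ s
  · rw [coreRow_eq_zero hs]
    exact Nat.zero_le _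
  · rw [h.coreRow_eq r, h.coreRow_eq s]
    have rowLen_le := lam.rowLen_anti r s hrs
    have := h r
    exact Nat.add_le_add rowLen_le (ih _ (by omega) (by omega) rfl)

lemma IsKBounded.exists_isCoreOf (h : IsKBounded k lam) : ∃ mu, IsCoreOf k mu lam := by
  obtain ⟨mu, hmu⟩ := exists_rowLen_eq h.coreRow_antitone (coreRow_eq_zero le_rfl)
  exact ⟨mu, isCoreOf_iff.mpr fun r => ⟨h r, by rw [hmu, hmu, ← h.coreRow_eq]⟩⟩

end CoreRow

/-! ### Coordinates on `V k` -/

section Coordinates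

variable {k : ℕ}

/-- The coefficients of `x` with respect to the simple roots, indexed from `1` as in the paper and
extended by `0`. -/
def rootCoeff (x : V k) : ℕ → ℝ
  | 0 => 0
  | a + 1 => if h : a < k then x ⟨a, h⟩ else 0

/-- The coordinates (of index `0, …, k`) of `x` when `V k` is realised as the sum-zero hyperplane
of `ℝ^(k+1)`, with simple roots `e_{i-1} - e_i`. -/
def coord (x : V k) (r : ℕ) : ℝ := rootCoeff x (r + 1) - rootCoeff x r

lemma rootCoeff_succ (x : V k) (i : Fin k) : rootCoeff x (i + 1) = x i := by
  simp [rootCoeff]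

lemma rootCoeff_last (x : V k) : rootCoeff x (k + 1) = 0 := by
  simp [rootCoeff]

lemma form_simpleRoot_eq_coord (i : Fin k) (x : V k) :
    form k (simpleRoot i) x = coord x i - coord x (i + 1) := by
  have floor_add_one (n : ℕ) : ⌊(n : ℝ) + 1⌋₊ = n + 1 := by
    exact_mod_cast Nat.floor_natCast (R := ℝ) (n + 1)
  have h := sum_cartan k i (fun t => rootCoeff x ⌊t + 1⌋₊) (by simp [rootCoeff])
    (by simp only [floor_add_one, rootCoeff_last])
  simp only [← Nat.cast_add_one, rootCoeff_succ, sub_add_cancel,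
    Nat.floor_natCast] at h
  rw [form_simpleRoot, coord, coord, rootCoeff_succ]
  linarith

lemma form_highestRoot_eq_coord (x : V k) :
    form k (highestRoot k) x = coord x 0 - coord x k := by
  rw [highestRoot, map_sum, LinearMap.sum_apply,
    Finset.sum_congr rfl fun i _ => form_simpleRoot_eq_coord i x,
    Fin.sum_univ_eq_sum_range (fun i => coord x i - coord x (i + 1)), Finset.sum_range_sub']

lemma rootCoeff_sub_smul (x y : V k) (t : ℝ) (a : ℕ) :
    rootCoeff (x - t • y) a = rootCoeff x a - t * rootCoeff y a := by
  cases a with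
  | zero => simp [rootCoeff]
  | succ a =>
    simp only [rootCoeff]
    split_ifs <;> simp

lemma coord_sub_smul (x y : V k) (t : ℝ) (a : ℕ) :
    coord (x - t • y) a = coord x a - t * coord y a := by
  simp only [coord, rootCoeff_sub_smul]
  ring

lemma coord_simpleRoot (i : Fin k) (a : ℕ) :
    coord (simpleRoot i) a = if a = i then 1 else if a = i + 1 then -1 else 0 := by
  have rootCoeff_eq (b : ℕ) : rootCoeff (simpleRoot i) b = if b = i + 1 then 1 else 0 := by
    cases b with
    | zero => simp [rootCoeff]
    | succ b => simp only [rootCoeff, simpleRoot, Pi.single_apply, Fin.ext_iff]; grind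
  simp only [coord, rootCoeff_eq]
  split_ifs <;> first | omega | norm_num

lemma coord_highestRoot [NeZero k] {a : ℕ} (ha : a ≤ k) :
    coord (highestRoot k) a = if a = 0 then 1 else if a = k then -1 else 0 := by
  have highestRoot_apply (j) : highestRoot k j = 1 := by
    simp [highestRoot, simpleRoot, Finset.sum_apply, Pi.single_apply]
  have rootCoeff_eq (b : ℕ) : rootCoeff (highestRoot k) b = if 1 ≤ b ∧ b ≤ k then 1 else 0 := by
    cases b with
    | zero => simp [rootCoeff]
    | succ b => simp only [rootCoeff, highestRoot_apply]; grind
  have := NeZero.ne k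
  simp only [coord, rootCoeff_eq]
  split_ifs <;> first | omega | norm_num

lemma sum_coord (x : V k) : ∑ i : Fin (k + 1), coord x i = 0 := by
  rw [Fin.sum_univ_eq_sum_range (coord x)]
  simp only [coord, Finset.sum_range_sub, rootCoeff_last]
  simp [rootCoeff]

lemma exists_coord_eq {X : Fin (k + 1) → ℝ} (hX : ∑ i, X i = 0) :
    ∃ x : V k, ∀ i : Fin (k + 1), coord x i = X i := by
  let Y : ℕ → ℝ := fun a => if h : a < k + 1 then X ⟨a, h⟩ else 0
  have Y_eq : ∀ i : Fin (k + 1), Y i = X i := fun i => dif_pos i.isLt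
  have sum_Y : ∑ a ∈ Finset.range (k + 1), Y a = 0 := by
    rw [← hX, ← Fin.sum_univ_eq_sum_range]
    exact Finset.sum_congr rfl fun i _ => Y_eq i
  let x : V k := fun j => ∑ a ∈ Finset.range (j + 1), Y a
  have rootCoeff_x : ∀ a ≤ k + 1, rootCoeff x a = ∑ b ∈ Finset.range a, Y b := by
    rintro (_ | a) ha
    · simp [rootCoeff]
    · rcases (Nat.le_of_succ_le_succ ha).lt_or_eq with h | rfl
      · exact rootCoeff_succ x ⟨a, h⟩
      · rw [rootCoeff_last, sum_Y]
  refine ⟨x, fun i => ?_⟩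
  rw [coord, rootCoeff_x _ (by omega), rootCoeff_x _ (by omega), Finset.sum_range_succ,
    add_sub_cancel_left, Y_eq]

lemma eq_of_coord_eq {x y : V k} (h : ∀ i : Fin (k + 1), coord x i = coord y i) : x = y := by
  have rootCoeff_eq : ∀ a ≤ k + 1, rootCoeff x a = rootCoeff y a := by
    intro a
    induction a with
    | zero => simp [rootCoeff]
    | succ a ih =>
      intro ha
      have coord_eq := h ⟨a, by omega⟩
      simp only [coord, ih (by omega)] at coord_eq
      exact sub_left_injective coord_eq
  funext i
  rw [← rootCoeff_succ x, ← rootCoeff_succ y]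
  exact rootCoeff_eq _ (by omega)

lemma coord_gen_succ (i : Fin k) (x : V k) (a : ℕ) :
    coord (gen i.succ x) a =
      if a = i then coord x (i + 1) else if a = i + 1 then coord x i else coord x a := by
  have gen_apply : gen i.succ x = x - (2 * (form k (simpleRoot i) x - 0) /
    form k (simpleRoot i) (simpleRoot i)) • simpleRoot i := rfl
  rw [gen_apply, coord_sub_smul]
  simp only [form_simpleRoot_eq_coord, coord_simpleRoot]
  split_ifs <;> grind

lemma coord_gen_zero [NeZero k] (x : V k) {a : ℕ} (ha : a ≤ k) :
    coord (gen 0 x) a =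
      if a = 0 then coord x k + 1 else if a = k then coord x 0 - 1 else coord x a := by
  have gen_apply : gen 0 x = x - (2 * (form k (highestRoot k) x - 1) /
    form k (highestRoot k) (highestRoot k)) • highestRoot k := rfl
  have := NeZero.ne k
  rw [gen_apply, coord_sub_smul, form_highestRoot_eq_coord, form_highestRoot_eq_coord,
    coord_highestRoot (Nat.zero_le k), coord_highestRoot le_rfl, coord_highestRoot ha]
  split_ifs <;> grind

end Coordinates

/-! ### Affine coordinates -/

section AffineCoordinates

variable {k : ℕ}

/-- The extension of the coordinates of `x` to a function on `ℤ` that decreases by `1` under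
translation by `k + 1`. -/
noncomputable def affCoord (x : V k) (a : ℤ) : ℝ :=
  coord x (a % (k + 1)).toNat - ((a / (k + 1) : ℤ) : ℝ)

lemma exists_eq_add_mul (a : ℤ) :
    ∃ (i : Fin (k + 1)) (t : ℤ), a = (i : ℕ) + (k + 1) * t := by
  obtain ⟨i, hi⟩ := isResidueSystem_id.exists_cast_eq (a : ZMod (k + 1))
  exact ⟨i, cast_eq_cast_iff_exists.mp hi.symm⟩

lemma affCoord_add_mul (x : V k) (a t : ℤ) :
    affCoord x (a + (k + 1) * t) = affCoord x a - t := by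
  rw [affCoord, affCoord, Int.add_mul_emod_self_left, Int.add_mul_ediv_left _ _ (by omega)]
  push_cast
  ring

lemma affCoord_natCast (x : V k) {j : ℕ} (hj : j ≤ k) : affCoord x j = coord x j := by
  rw [affCoord, Int.emod_eq_of_lt (by omega) (by omega), Int.ediv_eq_zero_of_lt (by omega)
    (by omega), Int.toNat_natCast, Int.cast_zero, sub_zero]

lemma affCoord_add_one (x : V k) : affCoord x (k + 1) = coord x 0 - 1 := by
  have := affCoord_add_mul x ((0 : ℕ) : ℤ) 1
  rw [affCoord_natCast x (Nat.zero_le k)] at this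
  simpa using this

lemma affCoord_neg_one (x : V k) : affCoord x (-1) = coord x k + 1 := by
  have := affCoord_add_mul x k (-1)
  rw [affCoord_natCast x le_rfl] at this
  simpa using this

lemma natCast_eq_natCast_iff_of_le {a b : ℕ} (ha : a ≤ k) (hb : b ≤ k) :
    (a : ZMod (k + 1)) = b ↔ a = b := by
  rw [ZMod.natCast_eq_natCast_iff', Nat.mod_eq_of_lt (by omega), Nat.mod_eq_of_lt (by omega)]

lemma mem_fundamentalAlcove_iff (x : V k) :
    x ∈ fundamentalAlcove k ↔ Antitone (affCoord x) := by
  have mem_iff : x ∈ fundamentalAlcove k ↔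
      (∀ i : Fin k, coord x (i + 1) ≤ coord x i) ∧ coord x 0 - 1 ≤ coord x k := by
    simp only [fundamentalAlcove, dominantChamber, Set.mem_ofPred_eq, form_simpleRoot_eq_coord,
      form_highestRoot_eq_coord, sub_nonneg, sub_le_comm]
  rw [mem_iff]
  constructor
  · rintro ⟨hsimple, hhighest⟩
    refine antitone_int_of_succ_le fun a => ?_
    obtain ⟨j, t, rfl⟩ := exists_eq_add_mul (k := k) a
    rw [add_right_comm, affCoord_add_mul, affCoord_add_mul, sub_le_sub_iff_right,
      affCoord_natCast x (Nat.le_of_lt_succ j.isLt)]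
    rcases (Nat.le_of_lt_succ j.isLt).lt_or_eq with hj | hj
    · exact_mod_cast (affCoord_natCast x hj).trans_le (hsimple ⟨j, hj⟩)
    · rw [hj, affCoord_add_one]
      exact hhighest
  · refine fun h => ⟨fun i => ?_, ?_⟩
    · rw [← affCoord_natCast x (by omega), ← affCoord_natCast x (by omega)]
      exact h (by omega)
    · rw [← affCoord_add_one, ← affCoord_natCast x le_rfl]
      exact h (by omega)

variable [NeZero k]

lemma affCoord_gen_succ (i : Fin k) (x : V k) {j : ℕ} (hj : j ≤ k) :
    affCoord (gen i.succ x) j = affCoord x (affSwap ((i.succ : ℕ) : ZMod (k + 1)) j) := by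
  rw [affCoord_natCast _ hj, coord_gen_succ]
  split_ifs with h₁ h₂
  · rw [affSwap_of_add_one_eq (by simp [h₁]), ← affCoord_natCast x (by omega), h₁, Nat.cast_succ]
  · rw [affSwap_of_eq (by simp [h₂]), ← affCoord_natCast x (by omega), h₂]
    push_cast
    rw [add_sub_cancel_right]
  · have residue_ne : (j : ZMod (k + 1)) ≠ (i.succ : ℕ) := by
      rwa [Ne, natCast_eq_natCast_iff_of_le hj (by omega), Fin.val_succ]
    have next_ne : (j : ZMod (k + 1)) + 1 ≠ (i.succ : ℕ) := by
      rw [Fin.val_succ, Nat.cast_succ, Ne, add_left_inj,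
        natCast_eq_natCast_iff_of_le hj (by omega)]
      exact h₁
    rw [affSwap_of_ne (by exact_mod_cast next_ne) (by exact_mod_cast residue_ne),
      affCoord_natCast x hj]

lemma affCoord_gen_zero (x : V k) {j : ℕ} (hj : j ≤ k) :
    affCoord (gen 0 x) j = affCoord x (affSwap (0 : ZMod (k + 1)) j) := by
  rw [affCoord_natCast _ hj, coord_gen_zero x hj]
  have period : (k : ZMod (k + 1)) + 1 = 0 := by exact_mod_cast ZMod.natCast_self (k + 1)
  split_ifs with h₁ h₂
  · rw [affSwap_of_eq (by simp [h₁]), h₁, Nat.cast_zero, zero_sub, affCoord_neg_one]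
  · rw [affSwap_of_add_one_eq (by simp [h₂, period]), h₂, affCoord_add_one]
  · have residue_ne : (j : ZMod (k + 1)) ≠ 0 := by
      have := natCast_eq_natCast_iff_of_le hj (Nat.zero_le k)
      rwa [Ne, ← Nat.cast_zero, this]
    have next_ne : (j : ZMod (k + 1)) + 1 ≠ 0 := by
      rwa [← period, Ne, add_left_inj, natCast_eq_natCast_iff_of_le hj le_rfl]
    rw [affSwap_of_ne (by exact_mod_cast next_ne) (by exact_mod_cast residue_ne),
      affCoord_natCast x hj]

lemma affCoord_gen (i : Fin (k + 1)) (x : V k) (a : ℤ) :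
    affCoord (gen i x) a = affCoord x (affSwap ((i : ℕ) : ZMod (k + 1)) a) := by
  obtain ⟨j, t, rfl⟩ := exists_eq_add_mul (k := k) a
  rw [affSwap_add_mul, affCoord_add_mul, affCoord_add_mul, sub_left_inj]
  cases i using Fin.cases with
  | zero => simpa using affCoord_gen_zero x (Nat.le_of_lt_succ j.isLt)
  | succ i => exact affCoord_gen_succ i x (Nat.le_of_lt_succ j.isLt)

lemma affCoord_word (l : List (Fin (k + 1))) (x : V k) (a : ℤ) :
    affCoord ((l.map gen).prod x) (wordPerm l a) = affCoord x a := by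
  induction l with
  | nil => rfl
  | cons i l ih =>
    rw [List.map_cons, List.prod_cons, Equiv.Perm.mul_apply, affCoord_gen, wordPerm_cons,
      affSwap_involutive, ih]

end AffineCoordinates

/-! ### Alcoves -/

section Alcoves

variable {k : ℕ} {g : Fin (k + 1) → ℤ}

/-- The alcove with window `g`: a chain of inequalities between the affine coordinates of `x`, in
the order in which the affine permutation with window `g` arranges `ℤ`. -/
def windowAlcove (g : Fin (k + 1) → ℤ) : Set (V k) :=
  {x | ∀ (i j : Fin (k + 1)) (t : ℤ), g i ≤ g j + (k + 1) * t → coord x j - t ≤ coord x i}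

lemma mem_alcove_iff (w : Equiv.Perm (V k)) (x : V k) :
    x ∈ alcove w ↔ w x ∈ fundamentalAlcove k := by
  simp only [alcove, Set.mem_image, Equiv.Perm.inv_eq_iff_eq, exists_eq_right]

lemma alcove_word [NeZero k] (l : List (Fin (k + 1))) :
    alcove (l.map gen).prod = windowAlcove (wordWindow l) := by
  ext x
  rw [mem_alcove_iff, mem_fundamentalAlcove_iff]
  constructor
  · intro h i j t hij
    have perm_le : wordPerm l (i : ℕ) ≤ wordPerm l ((j : ℕ) + (k + 1) * t) := by
      rwa [wordPerm_add_mul]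
    simpa only [affCoord_word, affCoord_add_mul, affCoord_natCast x (Fin.is_le _)] using h perm_le
  · intro h a b hab
    obtain ⟨a, rfl⟩ := (wordPerm l).surjective a
    obtain ⟨b, rfl⟩ := (wordPerm l).surjective b
    obtain ⟨i, s, rfl⟩ := exists_eq_add_mul (k := k) a
    obtain ⟨j, t, rfl⟩ := exists_eq_add_mul (k := k) b
    simp only [wordPerm_add_mul] at hab
    have coord_le := h i j (t - s) (by unfold wordWindow; linarith)
    simp only [affCoord_word, affCoord_add_mul, affCoord_natCast x (Fin.is_le _)]
    push_cast at coord_le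
    linarith

lemma exists_center (g : Fin (k + 1) → ℤ) :
    ∃ x : V k, ∀ (i j : Fin (k + 1)) (t : ℤ),
      coord x j - t ≤ coord x i ↔ g i ≤ g j + (k + 1) * t := by
  have hk : (0 : ℝ) < k + 1 := by positivity
  obtain ⟨x, hx⟩ := exists_coord_eq (X := fun i => ((∑ j, (g j : ℝ)) / (k + 1) - g i) / (k + 1))
    (by
      rw [← Finset.sum_div, Finset.sum_sub_distrib]
      simp [mul_div_cancel₀ _ hk.ne'])
  refine ⟨x, fun i j t => ?_⟩
  have coord_sub_eq : coord x i - (coord x j - t) =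
      ((g j + (k + 1) * t : ℤ) - (g i : ℝ)) / (k + 1) := by
    rw [hx, hx]
    push_cast
    field_simp
    ring
  rw [← sub_nonneg, coord_sub_eq, le_div_iff₀ hk, zero_mul, sub_nonneg, Int.cast_le]

lemma windowAlcove_subset_dominantChamber (hg : StrictMono g) :
    windowAlcove g ⊆ dominantChamber k := by
  intro x hx i
  rw [form_simpleRoot_eq_coord, sub_nonneg]
  simpa using hx i.castSucc i.succ 0 (by simpa using hg.monotone i.castSucc_le_succ)

lemma IsResidueSystem.strictMono_of_subset_dominantChamber (hg : IsResidueSystem g)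
    (h : windowAlcove g ⊆ dominantChamber k) : StrictMono g := by
  obtain ⟨x, hx⟩ := exists_center g
  refine Fin.strictMono_iff_lt_succ.mpr fun i => ?_
  have coord_le := h (fun i j t => (hx i j t).mpr) i
  rw [form_simpleRoot_eq_coord, sub_nonneg] at coord_le
  have le_succ := (hx i.castSucc i.succ 0).mp (by simpa using coord_le)
  rw [mul_zero, add_zero] at le_succ
  exact le_succ.lt_of_ne fun h => i.castSucc_lt_succ.ne (hg.eq_of_cast_eq (by rw [h]))

lemma IsResidueSystem.highestRoot_le_iff [NeZero k] (hg : IsResidueSystem g) (m : ℕ) :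
    (∀ x ∈ windowAlcove g, form k (highestRoot k) x ≤ m) ↔
      g (Fin.last k) < g 0 + (k + 1) * m := by
  simp only [form_highestRoot_eq_coord]
  constructor
  · intro h
    obtain ⟨x, hx⟩ := exists_center g
    have coord_le := h x fun i j t => (hx i j t).mpr
    have le_add := (hx (Fin.last k) 0 m).mp (by simpa [add_comm] using coord_le)
    refine le_add.lt_of_ne fun heq => NeZero.ne k ?_
    have := hg.eq_of_cast_eq (cast_eq_cast_iff_exists.mpr ⟨m, heq⟩)
    simpa using congrArg Fin.val this
  · intro h x hx
    simpa [add_comm] using hx (Fin.last k) 0 m h.le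

lemma exists_eq_add_of_strictMono {R : Equiv.Perm ℤ} (hR : StrictMono R) :
    ∃ c, ∀ a, R a = a + c := by
  have map_add_one (a : ℤ) : R (a + 1) = R a + 1 :=
    OrderIso.map_succ (StrictMono.orderIsoOfSurjective R hR R.surjective) a
  refine ⟨R 0, fun a => ?_⟩
  induction a using Int.induction_on with
  | zero => simp
  | succ i ih => rw [map_add_one, ih]; ring
  | pred i ih =>
    have := map_add_one (-i - 1)
    rw [sub_add_cancel, ih] at this
    linarith

lemma wordPerm_lt_of_windowAlcove_eq [NeZero k] {l l' : List (Fin (k + 1))}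
    (h : windowAlcove (wordWindow l) = windowAlcove (wordWindow l')) {a b : ℤ}
    (hab : wordPerm l' a < wordPerm l' b) : wordPerm l a < wordPerm l b := by
  obtain ⟨x, hx⟩ := exists_center (wordWindow l)
  have x_mem : x ∈ windowAlcove (wordWindow l') := h ▸ fun i j t => (hx i j t).mpr
  refine lt_of_le_of_ne ?_ fun heq => hab.ne (congrArg _ ((wordPerm l).injective heq))
  obtain ⟨i, s, rfl⟩ := exists_eq_add_mul (k := k) a
  obtain ⟨j, t, rfl⟩ := exists_eq_add_mul (k := k) b
  simp only [wordPerm_add_mul] at hab ⊢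
  have := (hx i j (t - s)).mp (x_mem i j (t - s) (by unfold wordWindow; linarith))
  unfold wordWindow at this
  linarith

lemma IsWindow.eq_of_windowAlcove_eq [NeZero k] {g' : Fin (k + 1) → ℤ} (hg : IsWindow g)
    (hg' : IsWindow g') (h : windowAlcove g = windowAlcove g') : g = g' := by
  obtain ⟨l, rfl⟩ := hg.exists_word
  obtain ⟨l', rfl⟩ := hg'.exists_word
  obtain ⟨c, hc⟩ := exists_eq_add_of_strictMono (R := (wordPerm l')⁻¹.trans (wordPerm l))
    fun a b hab => wordPerm_lt_of_windowAlcove_eq h (by simpa using hab)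
  have window_eq (j) : wordWindow l j = wordWindow l' j + c := by
    simpa [wordWindow] using hc (wordWindow l' j)
  have sum_eq := hg.sum.trans hg'.sum.symm
  simp only [window_eq, Finset.sum_add_distrib] at sum_eq
  have c_eq_zero : c = 0 := by simpa [Nat.cast_add_one_ne_zero] using sum_eq
  funext j
  rw [window_eq, c_eq_zero, add_zero]

lemma gen_mul_gen (i : Fin (k + 1)) : (gen i : Equiv.Perm (V k)) * gen i = 1 := by
  ext1 x
  cases i using Fin.cases with
  | zero => exact (reflection (highestRoot k) 1).left_inv x
  | succ j => exact (reflection (simpleRoot j) 0).left_inv x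

lemma mem_affineWeyl_iff {w : Equiv.Perm (V k)} :
    w ∈ affineWeyl k ↔ ∃ l : List (Fin (k + 1)), w = (l.map gen).prod := by
  constructor
  · intro hw
    induction hw using Subgroup.closure_induction with
    | mem x hx =>
      obtain ⟨i, rfl⟩ := hx
      exact ⟨[i], by simp⟩
    | one => exact ⟨[], rfl⟩
    | mul x y _ _ hx hy =>
      obtain ⟨l, rfl⟩ := hx
      obtain ⟨l', rfl⟩ := hy
      exact ⟨l ++ l', by simp⟩
    | inv x _ hx =>
      obtain ⟨l, rfl⟩ := hx
      refine ⟨l.reverse, ?_⟩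
      have inv_gen : (fun w : Equiv.Perm (V k) => w⁻¹) ∘ gen = gen :=
        funext fun i => inv_eq_of_mul_eq_one_left (gen_mul_gen i)
      rw [List.prod_inv_reverse, List.map_reverse, List.map_map, inv_gen]
  · rintro ⟨l, rfl⟩
    refine Subgroup.list_prod_mem _ fun x hx => ?_
    obtain ⟨i, -, rfl⟩ := List.mem_map.mp hx
    exact Subgroup.subset_closure ⟨i, rfl⟩

lemma mem_dominantAlcoves_iff [NeZero k] (m : ℕ) (A : Set (V k)) :
    A ∈ dominantAlcoves k m ↔ ∃ g : Fin (k + 1) → ℤ, IsWindow g ∧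
      g (Fin.last k) < g 0 + (k + 1) * m ∧ A = windowAlcove g := by
  constructor
  · rintro ⟨⟨w, hw, rfl⟩, hchamber, hbound⟩
    obtain ⟨l, rfl⟩ := mem_affineWeyl_iff.mp hw
    rw [alcove_word] at hchamber hbound ⊢
    have residue := isResidueSystem_wordWindow l
    exact ⟨_, ⟨residue.strictMono_of_subset_dominantChamber hchamber, residue, sum_wordWindow l⟩,
      (residue.highestRoot_le_iff m).mp hbound, rfl⟩
  · rintro ⟨g, hg, hm, rfl⟩
    obtain ⟨l, rfl⟩ := hg.exists_word
    exact ⟨⟨_, mem_affineWeyl_iff.mpr ⟨l, rfl⟩, (alcove_word l).symm⟩,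
      windowAlcove_subset_dominantChamber hg.strictMono, (hg.residue.highestRoot_le_iff m).mpr hm⟩

end Alcoves

/-! ### The partition attached to a window -/

section Residue

variable {k : ℕ}

lemma add_period_le {a b : ℤ} (h : (a : ZMod (k + 1)) = b) (hab : a < b) : a + (k + 1) ≤ b := by
  by_contra! hlt
  have := eq_zero_of_cast_eq_zero_of_abs_lt (k := k) (a := b - a) (by simp [h])
    (by rw [abs_lt]; omega)
  omega

lemma exists_cast_eq_and_le_and_lt (c : ZMod (k + 1)) (x : ℤ) :
    ∃ a : ℤ, (a : ZMod (k + 1)) = c ∧ a ≤ x ∧ x < a + (k + 1) := by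
  obtain ⟨c, rfl⟩ := ZMod.intCast_surjective c
  have nonneg := Int.emod_nonneg (x - c) (show (k + 1 : ℤ) ≠ 0 by omega)
  have lt := Int.emod_lt_of_pos (x - c) (show (0 : ℤ) < k + 1 by omega)
  have div_add_mod := Int.emod_add_mul_ediv (x - c) (k + 1)
  exact ⟨x - (x - c) % (k + 1),
    cast_eq_cast_iff_exists.mpr ⟨(x - c) / (k + 1), by linarith⟩, by omega, by omega⟩

lemma card_Ico_filter_cast_eq (a b : ℤ) :
    ((Finset.Ico a b).filter fun x : ℤ => (x : ZMod (k + 1)) = b).card =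
      ((b - a) / (k + 1)).toNat := by
  have count := Int.Ico_filter_modEq_card a b (r := k + 1) (by omega) b
  have ceil_eq : ⌈((a : ℚ) - b) / ((k + 1 : ℤ) : ℚ)⌉ = -((b - a) / (k + 1)) := by
    rw [← neg_sub (b : ℚ), neg_div, Int.ceil_neg, neg_inj]
    exact_mod_cast Rat.floor_intCast_div_natCast (b - a) (k + 1)
  rw [ceil_eq, sub_self, zero_div, Int.ceil_zero, zero_sub, neg_neg] at count
  have modEq_iff (x : ℤ) : (x : ZMod (k + 1)) = b ↔ x ≡ b [ZMOD k + 1] := by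
    exact_mod_cast ZMod.intCast_eq_intCast_iff x b (k + 1)
  simp only [modEq_iff]
  omega

end Residue

section Shape

variable {k : ℕ} {g g' : Fin (k + 1) → ℤ} {lam lam' mu : YoungDiagram}

/-- The bead set of the core with window `g`. -/
def windowBeads (g : Fin (k + 1) → ℤ) : Set ℤ := {b | ∃ i, (g i : ZMod (k + 1)) = b ∧ b < g i}

/-- `lam` is the bounded partition of the core with window `g`. -/
def IsShape (g : Fin (k + 1) → ℤ) (lam : YoungDiagram) : Prop :=
  ∃ mu, beadSet mu = windowBeads g ∧ IsCoreOf k mu lam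

lemma windowBeads_eq_of_range_eq (h : Set.range g = Set.range g') :
    windowBeads g = windowBeads g' := by
  have eq_range (f : Fin (k + 1) → ℤ) :
      windowBeads f = {b : ℤ | ∃ a ∈ Set.range f, (a : ZMod (k + 1)) = b ∧ b < a} := by
    simp [windowBeads]
  rw [eq_range, eq_range, h]

lemma windowBeads_id : windowBeads (fun i : Fin (k + 1) => ((i : ℕ) : ℤ)) = {b | b < 0} := by
  ext b
  constructor
  · rintro ⟨i, hi, hlt⟩
    have : b + (k + 1) ≤ (i : ℕ) := add_period_le hi.symm hlt
    exact Set.mem_ofPred_eq.mpr (by omega)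
  · intro hb
    obtain ⟨i, hi⟩ := exists_natCast_eq (k := k) (b : ZMod (k + 1))
    exact ⟨i, by exact_mod_cast hi, lt_of_lt_of_le hb (by simp)⟩

lemma image_windowBeads [NeZero k] (c : ZMod (k + 1)) (g : Fin (k + 1) → ℤ) :
    affSwapPerm c '' windowBeads g = windowBeads fun i => affSwap c (g i) := by
  have mapsTo (f : Fin (k + 1) → ℤ) {b : ℤ} (hb : b ∈ windowBeads f) :
      affSwap c b ∈ windowBeads fun i => affSwap c (f i) := by
    obtain ⟨i, hi, hlt⟩ := hb
    obtain ⟨t, ht⟩ := cast_eq_cast_iff_exists.mp hi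
    have affSwap_eq : affSwap c (f i) = affSwap c b + (k + 1) * t := by rw [ht, affSwap_add_mul]
    exact ⟨i, cast_eq_cast_iff_exists.mpr ⟨t, affSwap_eq⟩, by linarith⟩
  refine Set.Subset.antisymm (Set.image_subset_iff.mpr fun b hb => mapsTo g hb) fun b hb => ?_
  have := mapsTo _ hb
  simp only [affSwap_involutive c _] at this
  exact ⟨_, this, affSwap_involutive c b⟩

lemma beadSet_wordCore [NeZero k] (l : List (Fin (k + 1))) :
    beadSet (wordCore l) = windowBeads (wordWindow l) := by
  induction l with
  | nil => exact beadSet_bot.trans windowBeads_id.symm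
  | cons i l ih =>
    have := (beadClosed_wordCore l).beadSet_coreAct i
    rw [ih, image_windowBeads] at this
    exact this

lemma IsResidueSystem.notMem_windowBeads (hg : IsResidueSystem g) (i : Fin (k + 1)) :
    g i ∉ windowBeads g := by
  rintro ⟨j, hj, hlt⟩
  rw [hg.eq_of_cast_eq hj] at hlt
  exact lt_irrefl _ hlt

lemma IsResidueSystem.range_subset (hg : IsResidueSystem g) (h : windowBeads g = windowBeads g') :
    Set.range g ⊆ Set.range g' := by
  rintro _ ⟨i, rfl⟩
  have notMem := hg.notMem_windowBeads i
  have cast_sub : ((g i - (k + 1) : ℤ) : ZMod (k + 1)) = g i :=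
    cast_eq_cast_iff_exists.mpr ⟨-1, by ring⟩
  have mem : g i - (k + 1) ∈ windowBeads g := ⟨i, cast_sub.symm, by omega⟩
  rw [h] at notMem mem
  obtain ⟨j, hj, hlt⟩ := mem
  rw [cast_sub] at hj
  have le : g' j ≤ g i := not_lt.mp fun hgt => notMem ⟨j, hj, hgt⟩
  refine ⟨j, le.antisymm (not_lt.mp fun hgt => ?_)⟩
  have := add_period_le hj hgt
  omega

lemma IsWindow.eq_of_windowBeads_eq (hg : IsWindow g) (hg' : IsWindow g')
    (h : windowBeads g = windowBeads g') : g = g' :=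
  (hg.strictMono.range_inj hg'.strictMono).mp
    ((hg.residue.range_subset h).antisymm (hg'.residue.range_subset h.symm))

lemma IsShape.unique (h : IsShape g lam) (h' : IsShape g lam') : lam = lam' := by
  obtain ⟨mu, hmu, hlam⟩ := h
  obtain ⟨nu, hnu, hlam'⟩ := h'
  obtain rfl := eq_of_beadSet_eq (hmu.trans hnu.symm)
  exact hlam.partition_unique hlam'

lemma IsShape.window_unique (hg : IsWindow g) (hg' : IsWindow g') (h : IsShape g lam)
    (h' : IsShape g' lam) : g = g' := by
  obtain ⟨mu, hmu, hlam⟩ := h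
  obtain ⟨nu, hnu, hlam'⟩ := h'
  obtain rfl := hlam.core_unique hlam'
  exact hg.eq_of_windowBeads_eq hg' (hmu.symm.trans hnu)

lemma IsWindow.exists_isShape [NeZero k] (hg : IsWindow g) : ∃ lam, IsShape g lam := by
  obtain ⟨l, rfl⟩ := hg.exists_word
  obtain ⟨lam, h⟩ := (beadClosed_wordCore l).exists_isCoreOf
  exact ⟨lam, _, beadSet_wordCore l, h⟩

lemma IsResidueSystem.exists_isWindow (hg : IsResidueSystem g)
    (hsum : ∑ i, g i = ∑ i : Fin (k + 1), ((i : ℕ) : ℤ)) :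
    ∃ g' : Fin (k + 1) → ℤ, IsWindow g' ∧ Set.range g' = Set.range g := by
  let e := Tuple.sort g
  have residue : IsResidueSystem (g ∘ e) := hg.comp e.bijective
  refine ⟨g ∘ e, ⟨?_, residue, (Equiv.sum_comp e g).trans hsum⟩, EquivLike.range_comp g e⟩
  exact (Tuple.monotone_sort g).strictMono_of_injective fun i j hij =>
    residue.eq_of_cast_eq (congrArg Int.cast hij)

lemma exists_window_of_isKBounded [NeZero k] (h : IsKBounded k lam) :
    ∃ g : Fin (k + 1) → ℤ, IsWindow g ∧ IsShape g lam := by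
  obtain ⟨mu, hmu⟩ := h.exists_isCoreOf
  obtain ⟨l, rfl⟩ := hmu.beadClosed.exists_wordCore
  obtain ⟨g, hg, range_eq⟩ := (isResidueSystem_wordWindow l).exists_isWindow (sum_wordWindow l)
  exact ⟨g, hg, _, (beadSet_wordCore l).trans (windowBeads_eq_of_range_eq range_eq.symm), hmu⟩

lemma corresponds_iff [NeZero k] (lam : YoungDiagram) (A : Set (V k)) :
    Corresponds k lam A ↔
      ∃ g : Fin (k + 1) → ℤ, IsWindow g ∧ A = windowAlcove g ∧ IsShape g lam := by
  constructor
  · rintro ⟨hA, l, rfl, hl⟩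
    rw [alcove_word] at hA ⊢
    have residue := isResidueSystem_wordWindow l
    exact ⟨_, ⟨residue.strictMono_of_subset_dominantChamber hA, residue, sum_wordWindow l⟩, rfl,
      _, beadSet_wordCore l, hl⟩
  · rintro ⟨g, hg, rfl, mu, hmu, hlam⟩
    refine ⟨windowAlcove_subset_dominantChamber hg.strictMono, ?_⟩
    obtain ⟨l, rfl⟩ := hg.exists_word
    obtain rfl := eq_of_beadSet_eq (hmu.trans (beadSet_wordCore l).symm)
    exact ⟨l, (alcove_word l).symm, hlam⟩

lemma IsShape.isKBounded (h : IsShape g lam) : IsKBounded k lam := by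
  obtain ⟨mu, -, hlam⟩ := h
  exact hlam.isKBounded

lemma IsShape.colLen_eq_zero (h : IsShape g lam) {c : ℕ} (hc : k ≤ c) : lam.colLen c = 0 := by
  refine Nat.eq_zero_of_not_pos fun hpos => ?_
  have := (lt_colLen_iff_lt_rowLen lam).mp hpos
  have := h.isKBounded 0
  omega

end Shape

/-! ### Row lengths, column lengths and size -/

section Size

variable {k : ℕ} {g : Fin (k + 1) → ℤ} {lam lam' mu : YoungDiagram}

lemma lt_card_filter_iff (hg : Monotone g) (b : ℤ) (c : Fin (k + 1)) :
    (c : ℕ) < (Finset.univ.filter fun i => g i < b).card ↔ g c < b := by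
  constructor
  · intro h
    by_contra! hc
    have : (Finset.univ.filter fun i => g i < b) ⊆ Finset.Iio c := fun i hi =>
      Finset.mem_Iio.mpr <| hg.reflect_lt <| (Finset.mem_filter.mp hi).2.trans_le hc
    have := Finset.card_le_card this
    rw [Fin.card_Iio] at this
    omega
  · intro h
    have : Finset.Iic c ⊆ (Finset.univ.filter fun i => g i < b) := fun i hi =>
      Finset.mem_filter.mpr ⟨Finset.mem_univ i, (hg (Finset.mem_Iic.mp hi)).trans_lt h⟩
    have := Finset.card_le_card this
    rw [Fin.card_Iic] at this
    omega

lemma IsCoreOf.image_bead_Ico (h : IsCoreOf k mu lam) (hmu : beadSet mu = windowBeads g) (r : ℕ) :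
    (Finset.Ico r (r + (k + 1 - lam.rowLen r))).image (fun s => (bead mu s : ZMod (k + 1))) =
      (Finset.univ.filter fun i => bead mu r < g i).image fun i => (g i : ZMod (k + 1)) := by
  have bead_end := h.bead_add_eq r
  ext c
  simp only [Finset.mem_image, Finset.mem_Ico, Finset.mem_filter, Finset.mem_univ, true_and]
  constructor
  · rintro ⟨s, ⟨-, hs⟩, rfl⟩
    obtain ⟨i, hi, hlt⟩ := hmu ▸ bead_mem mu s
    refine ⟨i, ?_, hi⟩
    have := add_period_le hi.symm hlt
    have := bead_strictAnti mu hs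
    omega
  · rintro ⟨i, hi, rfl⟩
    obtain ⟨a, ha, ha_le, lt_ha⟩ := exists_cast_eq_and_le_and_lt (g i : ZMod (k + 1)) (bead mu r)
    obtain ⟨s, rfl⟩ : a ∈ beadSet mu := hmu ▸ ⟨i, ha.symm, ha_le.trans_lt hi⟩
    exact ⟨s, ⟨(bead_strictAnti mu).le_iff_ge.mp ha_le,
      (bead_strictAnti mu).lt_iff_gt.mp (by omega)⟩, ha⟩

lemma IsCoreOf.rowLen_eq_card (h : IsCoreOf k mu lam) (hg : IsResidueSystem g)
    (hmu : beadSet mu = windowBeads g) (r : ℕ) :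
    lam.rowLen r = (Finset.univ.filter fun i => g i < bead mu r).card := by
  have bead_end := h.bead_add_eq r
  have injOn : Set.InjOn (fun s => (bead mu s : ZMod (k + 1)))
      (Finset.Ico r (r + (k + 1 - lam.rowLen r)) : Finset ℕ) := by
    intro s hs s' hs' hss
    rw [Finset.mem_coe, Finset.mem_Ico] at hs hs'
    have := eq_zero_of_cast_eq_zero_of_abs_lt (k := k) (a := bead mu s - bead mu s')
      (by simpa [sub_eq_zero] using hss) (by
        have := (bead_strictAnti mu).antitone hs.1
        have := (bead_strictAnti mu).antitone hs'.1
        have := bead_strictAnti mu hs.2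
        have := bead_strictAnti mu hs'.2
        rw [abs_lt]
        omega)
    exact (bead_strictAnti mu).injective (by omega)
  have card_above := congrArg Finset.card (h.image_bead_Ico hmu r)
  rw [Finset.card_image_of_injOn injOn, Finset.card_image_of_injective _ hg.injective,
    Nat.card_Ico] at card_above
  have not_lt_iff (i) : ¬ bead mu r < g i ↔ g i < bead mu r := by
    have : g i ≠ bead mu r := fun he => hg.notMem_windowBeads i (hmu ▸ he ▸ bead_mem mu r)
    omega
  have card_add := Finset.card_filter_add_card_filter_not (s := Finset.univ)
    fun i => bead mu r < g i
  simp only [not_lt_iff, Finset.card_univ, Fintype.card_fin] at card_add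
  have := (h.rowLen_le_and_rowLen_eq r).1
  omega

lemma IsCoreOf.lt_rowLen_iff (h : IsCoreOf k mu lam) (hg : IsWindow g)
    (hmu : beadSet mu = windowBeads g) (r : ℕ) (c : Fin (k + 1)) :
    (c : ℕ) < lam.rowLen r ↔ g c < bead mu r := by
  rw [h.rowLen_eq_card hg.residue hmu, lt_card_filter_iff hg.strictMono.monotone]

lemma IsShape.colLen_eq (h : IsShape g lam) (hg : IsWindow g) (c : Fin (k + 1)) :
    lam.colLen c = ∑ i, ((g i - g c) / (k + 1)).toNat := by
  obtain ⟨mu, hmu, hlam⟩ := h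
  have image_eq : (Finset.range (lam.colLen c)).image (bead mu) =
      Finset.univ.biUnion fun i =>
        (Finset.Ico (g c) (g i)).filter fun x : ℤ => (x : ZMod (k + 1)) = g i := by
    ext b
    simp only [Finset.mem_image, Finset.mem_range, Finset.mem_biUnion, Finset.mem_univ, true_and,
      Finset.mem_filter, Finset.mem_Ico, lt_colLen_iff_lt_rowLen, hlam.lt_rowLen_iff hg hmu]
    constructor
    · rintro ⟨r, hr, rfl⟩
      obtain ⟨i, hi, hlt⟩ := hmu ▸ bead_mem mu r
      exact ⟨i, ⟨hr.le, hlt⟩, hi.symm⟩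
    · rintro ⟨i, ⟨hle, hlt⟩, hi⟩
      have mem : b ∈ beadSet mu := hmu ▸ ⟨i, hi.symm, hlt⟩
      have ne : g c ≠ b := fun he => hg.residue.notMem_windowBeads c (hmu ▸ he ▸ mem)
      obtain ⟨r, rfl⟩ := mem
      exact ⟨r, lt_of_le_of_ne hle ne, rfl⟩
  have card_eq := congrArg Finset.card image_eq
  rw [Finset.card_image_of_injective _ (bead_strictAnti mu).injective, Finset.card_range,
    Finset.card_biUnion] at card_eq
  · rw [card_eq]
    exact Finset.sum_congr rfl fun i _ => card_Ico_filter_cast_eq (g c) (g i)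
  · intro i _ j _ hij
    refine Finset.disjoint_left.mpr fun b hi hj => hij ?_
    exact hg.residue.eq_of_cast_eq
      ((Finset.mem_filter.mp hi).2.symm.trans (Finset.mem_filter.mp hj).2)

/-- The pairs of a bead `b` of the core with window `g` and an entry `g i < b`. They are the cells
of the bounded partition of this core, the one in column `i` of the row with bead `b`. -/
def windowInversions (g : Fin (k + 1) → ℤ) : Set (ℤ × Fin (k + 1)) :=
  {x | x.1 ∈ windowBeads g ∧ g x.2 < x.1}

lemma IsShape.encard_windowInversions (h : IsShape g lam) (hg : IsWindow g) :
    (windowInversions g).encard = lam.card := by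
  obtain ⟨mu, hmu, hlam⟩ := h
  let cells : Set (ℕ × Fin (k + 1)) := {x | (x.2 : ℕ) < lam.rowLen x.1}
  have inversions_eq : windowInversions g = Prod.map (bead mu) id '' cells := by
    ext ⟨b, i⟩
    simp only [windowInversions, cells, ← hmu, Set.mem_ofPred_eq, Set.mem_image, Prod.exists,
      Prod.map_apply, id_eq, Prod.mk.injEq, hlam.lt_rowLen_iff hg hmu]
    constructor
    · rintro ⟨⟨r, rfl⟩, hi⟩
      exact ⟨r, i, hi, rfl, rfl⟩
    · rintro ⟨r, i, hi, rfl, rfl⟩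
      exact ⟨bead_mem mu r, hi⟩
  have cells_eq : (lam.cells : Set (ℕ × ℕ)) = Prod.map id Fin.val '' cells := by
    ext ⟨r, c⟩
    simp only [cells, SetLike.mem_coe, YoungDiagram.mem_cells,
      YoungDiagram.mem_iff_lt_rowLen, Set.mem_image, Set.mem_ofPred_eq, Prod.exists,
      Prod.map_apply, id_eq, Prod.mk.injEq]
    constructor
    · intro hc
      exact ⟨r, ⟨c, by have := hlam.isKBounded r; omega⟩, hc, rfl, rfl⟩
    · rintro ⟨r, c, hc, rfl, rfl⟩
      exact hc
  rw [inversions_eq, ((bead_strictAnti mu).injective.prodMap Function.injective_id).encard_image,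
    YoungDiagram.card, ← Set.encard_coe_eq_coe_finsetCard, cells_eq,
    (Function.injective_id.prodMap Fin.val_injective).encard_image]

variable [NeZero k] {c : ZMod (k + 1)}

/-- Swapping preserves the order of a bead and an entry unless they are exchanged. -/
lemma IsResidueSystem.windowInversions_eq_insert (hg : IsResidueSystem g) {a b : Fin (k + 1)}
    (ha : (g a : ZMod (k + 1)) + 1 = c) (hb : (g b : ZMod (k + 1)) = c) (hlt : g a + 1 < g b) :
    windowInversions g = insert (g a + 1, a)
      {x | x.1 ∈ windowBeads g ∧ affSwap c (g x.2) < affSwap c x.1} := by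
  ext ⟨x, i⟩
  simp only [windowInversions, Set.mem_ofPred_eq, Set.mem_insert_iff, Prod.mk.injEq]
  constructor
  · rintro ⟨hx, hi⟩
    by_cases h : x = g i + 1 ∧ (x : ZMod (k + 1)) = c
    · obtain rfl : i = a := hg.eq_of_cast_eq (add_right_cancel (b := (1 : ZMod (k + 1))) (by
        rw [ha, ← h.2, h.1, Int.cast_add, Int.cast_one]))
      exact Or.inl ⟨h.1, rfl⟩
    · exact Or.inr ⟨hx, affSwap_lt_affSwap hi fun hx hc => h ⟨hx, hc⟩⟩
  · rintro (⟨rfl, rfl⟩ | ⟨hx, hi⟩)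
    · exact ⟨⟨b, by rw [hb, ← ha]; simp, hlt⟩, lt_add_one _⟩
    · refine ⟨hx, lt_of_not_ge fun hle => ?_⟩
      rcases hle.eq_or_lt with rfl | hxi
      · exact lt_irrefl _ hi
      refine lt_asymm hi (affSwap_lt_affSwap hxi fun hx' hc => ?_)
      obtain rfl := hg.eq_of_cast_eq (hc.trans hb.symm)
      obtain ⟨j, hj, hxj⟩ := hx
      obtain rfl : j = a := hg.eq_of_cast_eq (add_right_cancel (b := (1 : ZMod (k + 1))) (by
        rw [ha, ← hc, hx', hj, Int.cast_add, Int.cast_one]))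
      omega

lemma IsResidueSystem.encard_windowInversions (hg : IsResidueSystem g) {a b : Fin (k + 1)}
    (ha : (g a : ZMod (k + 1)) + 1 = c) (hb : (g b : ZMod (k + 1)) = c) (hlt : g a + 1 < g b) :
    (windowInversions g).encard = (windowInversions fun i => affSwap c (g i)).encard + 1 := by
  have image_eq : windowInversions (fun i => affSwap c (g i)) =
      Prod.map (affSwapPerm c) id ''
        {x | x.1 ∈ windowBeads g ∧ affSwap c (g x.2) < affSwap c x.1} := by
    ext ⟨y, i⟩
    simp only [windowInversions, ← image_windowBeads, Set.mem_ofPred_eq, Set.mem_image,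
      Prod.exists, Prod.map_apply, id_eq, Prod.mk.injEq]
    constructor
    · rintro ⟨⟨x, hx, rfl⟩, hi⟩
      exact ⟨x, i, ⟨hx, hi⟩, rfl, rfl⟩
    · rintro ⟨x, i, ⟨hx, hi⟩, rfl, rfl⟩
      exact ⟨⟨x, hx, rfl⟩, hi⟩
  rw [image_eq, ((affSwapPerm c).injective.prodMap Function.injective_id).encard_image,
    hg.windowInversions_eq_insert ha hb hlt, Set.encard_insert_of_notMem]
  rintro ⟨-, h⟩
  rw [affSwap_of_add_one_eq ha, affSwap_of_eq (by simpa using ha)] at h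
  omega

lemma IsShape.card_affSwap (h : IsShape g lam) (h' : IsShape (fun i => affSwap c (g i)) lam')
    (hg : IsWindow g) (hg' : IsWindow fun i => affSwap c (g i)) :
    lam.card + 1 = lam'.card ∨ lam'.card + 1 = lam.card := by
  obtain ⟨a, ha⟩ := hg.residue.exists_cast_eq (c - 1)
  obtain ⟨b, hb⟩ := hg.residue.exists_cast_eq c
  replace ha : (g a : ZMod (k + 1)) + 1 = c := by rw [ha, sub_add_cancel]
  have affSwap_a := affSwap_of_add_one_eq ha
  have affSwap_b := affSwap_of_eq hb
  have card_eq := h.encard_windowInversions hg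
  have card_eq' := h'.encard_windowInversions hg'
  rcases lt_trichotomy (g a + 1) (g b) with hlt | heq | hgt
  · rw [hg.residue.encard_windowInversions ha hb hlt, card_eq'] at card_eq
    exact Or.inr (by exact_mod_cast card_eq)
  · have := hg'.strictMono (hg.strictMono.lt_iff_lt.mp ((lt_add_one _).trans_eq heq))
    omega
  · rw [hg'.residue.encard_windowInversions (c := c) (a := b) (b := a) (by simp [affSwap_b, hb])
      (by simp [affSwap_a, ha]) (by omega)] at card_eq'
    simp only [affSwap_involutive c _] at card_eq'
    rw [card_eq] at card_eq'
    exact Or.inl (by exact_mod_cast card_eq')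

end Size

/-! ### Partitions contained in unions of rectangles -/

section ColLen

lemma exists_lt_getElem_iff_lt_countP (c r : ℕ) {l : List ℕ} (hl : l.Pairwise (· ≥ ·)) :
    (∃ h : r < l.length, c < l[r]) ↔ r < l.countP (fun a => c < a) := by
  induction l generalizing r with
  | nil => simp
  | cons a l ih =>
    rw [List.pairwise_cons] at hl
    by_cases hca : c < a
    · rw [List.countP_cons_of_pos (by simpa using hca)]
      cases r with
      | zero => simp [hca]
      | succ r =>
        rw [Nat.add_lt_add_iff_right, ← ih r hl.2]
        simp
    · have le_of_mem : ∀ b ∈ a :: l, b ≤ c :=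
        List.forall_mem_cons.mpr ⟨not_lt.mp hca, fun b hb => (hl.1 b hb).trans (not_lt.mp hca)⟩
      rw [List.countP_eq_zero.mpr fun b hb => by simpa using le_of_mem b hb]
      exact iff_of_false (fun ⟨h, hc⟩ => hc.not_ge (le_of_mem _ (List.getElem_mem h)))
        (Nat.not_lt_zero r)

lemma colLen_ofParts (s : Multiset ℕ) (c : ℕ) :
    (ofParts s).colLen c = s.countP (fun a => c < a) := by
  refine eq_of_forall_lt_iff fun r => ?_
  rw [← YoungDiagram.mem_iff_lt_colLen, ofParts, YoungDiagram.mem_ofRowLens]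
  have := exists_lt_getElem_iff_lt_countP c r (Multiset.pairwise_sort s (· ≥ ·))
  rwa [← Multiset.coe_countP, Multiset.sort_eq] at this

lemma le_iff_colLen_le {mu nu : YoungDiagram} : mu ≤ nu ↔ ∀ c, mu.colLen c ≤ nu.colLen c := by
  constructor
  · intro h c
    refine le_of_forall_lt fun r hr => ?_
    rw [← YoungDiagram.mem_iff_lt_colLen] at hr ⊢
    exact h hr
  · rintro h ⟨r, c⟩ hx
    rw [YoungDiagram.mem_iff_lt_colLen] at hx ⊢
    exact hx.trans_le (h c)

end ColLen

section Rect

variable {k M : ℕ} {i : Fin M → ℕ} {g : Fin (k + 1) → ℤ}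

lemma countP_rectParts {a : ℕ} (ha : a ≤ k) (c : ℕ) :
    (rectParts k a).countP (fun b => c < b) =
      (Finset.univ.filter fun b : Fin (k + 1) => c < a ∧ a ≤ b).card := by
  rw [rectParts, ← Multiset.coe_replicate, Multiset.coe_countP, List.countP_replicate]
  by_cases hc : c < a
  · have : (Finset.univ.filter fun b : Fin (k + 1) => c < a ∧ a ≤ b) =
        Finset.Ici ⟨a, Nat.lt_succ_of_le ha⟩ := by
      ext b
      simp only [Finset.mem_filter, Finset.mem_univ, true_and, hc, Finset.mem_Ici, Fin.le_def]
    rw [this, Fin.card_Ici, if_pos (by simpa using hc)]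
  · simp [hc]

lemma colLen_ofParts_sum (hi : ∀ t, i t ≤ k) (c : ℕ) :
    (ofParts (∑ t, rectParts k (i t))).colLen c =
      ∑ a : Fin (k + 1), (Finset.univ.filter fun t => c < i t ∧ i t ≤ a).card := by
  have countP_sum : Multiset.countP (fun a => c < a) (∑ t, rectParts k (i t)) =
      ∑ t, Multiset.countP (fun a => c < a) (rectParts k (i t)) :=
    map_sum (Multiset.countPAddMonoidHom fun a => c < a) _ _
  rw [colLen_ofParts, countP_sum, Finset.sum_congr rfl fun t _ => countP_rectParts (hi t) c]
  simp only [Finset.card_filter]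
  exact Finset.sum_comm

lemma card_filter_and_le_add_card_filter (i : Fin M → ℕ) {c a : ℕ} (hca : c ≤ a) :
    (Finset.univ.filter fun t => c < i t ∧ i t ≤ a).card +
      (Finset.univ.filter fun t => a < i t).card = (Finset.univ.filter fun t => c < i t).card := by
  rw [← Finset.card_filter_add_card_filter_not (s := Finset.univ.filter fun t => c < i t)
    (fun t => i t ≤ a), Finset.filter_filter, Finset.filter_filter]
  congr 2
  ext t
  simp only [Finset.mem_filter, Finset.mem_univ, true_and]
  omega

lemma ediv_add_ediv_le (a b : ℤ) {r : ℤ} (hr : 0 < r) : a / r + b / r ≤ (a + b) / r := by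
  rw [Int.le_ediv_iff_mul_le hr, add_mul]
  exact add_le_add (Int.ediv_mul_le a hr.ne') (Int.ediv_mul_le b hr.ne')

lemma add_ediv_le (a b : ℤ) {r : ℤ} (hr : 0 < r) : (a + b) / r ≤ a / r + b / r + 1 := by
  rw [← Int.lt_add_one_iff, Int.ediv_lt_iff_lt_mul hr]
  linarith [Int.lt_ediv_add_one_mul_self a hr, Int.lt_ediv_add_one_mul_self b hr]

/-- If the bound failed at `j` and held at all `a > j`, then every summand at `c = j` would be at
least as large on the left as on the right, and the last one strictly larger. -/
lemma ediv_le_card_filter_of_sum_le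
    (h : ∀ c : Fin (k + 1), ∑ a, ((g a - g c) / (k + 1)).toNat ≤
      ∑ a : Fin (k + 1), (Finset.univ.filter fun t => (c : ℕ) < i t ∧ i t ≤ a).card)
    (j : Fin (k + 1)) :
    (g (Fin.last k) - g j) / (k + 1) ≤ (Finset.univ.filter fun t => (j : ℕ) < i t).card := by
  induction hN : k - (j : ℕ) using Nat.strong_induction_on generalizing j with
  | _ N ih =>
  by_contra! hcon
  have j_lt : (j : ℕ) < k := by
    by_contra hj
    obtain rfl : j = Fin.last k := Fin.ext (by simp only [Fin.val_last]; omega)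
    rw [sub_self, Int.zero_ediv] at hcon
    omega
  refine (h j).not_gt (Finset.sum_lt_sum (fun a _ => ?_) ⟨Fin.last k, Finset.mem_univ _, ?_⟩)
  · rcases le_or_gt (a : ℕ) j with haj | hja
    · rw [Finset.card_eq_zero.mpr (Finset.filter_eq_empty_iff.mpr fun t _ => by omega)]
      exact Nat.zero_le _
    · have split := card_filter_and_le_add_card_filter i hja.le
      have bound_a := ih _ (by omega) a rfl
      have ediv_le := add_ediv_le (g (Fin.last k) - g a) (g a - g j) (r := k + 1) (by omega)
      rw [sub_add_sub_cancel] at ediv_le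
      omega
  · have := card_filter_and_le_add_card_filter i j_lt.le
    rw [Fin.val_last]
    omega

lemma exists_toNat_sub_le_card_filter [NeZero k] {p : Fin (k + 1) → ℤ} (hp : Monotone p)
    (hp0 : p 0 = 0) (hpM : p (Fin.last k) ≤ M) :
    ∃ i : Fin M → ℕ, (∀ t, 1 ≤ i t ∧ i t ≤ k) ∧ ∀ c a : Fin (k + 1),
      (p a - p c).toNat ≤ (Finset.univ.filter fun t => (c : ℕ) < i t ∧ i t ≤ a).card := by
  have lt_card (t : ℕ) (a : Fin (k + 1)) :
      (a : ℕ) < (Finset.univ.filter fun b => p b < t + 1).card ↔ p a < t + 1 :=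
    lt_card_filter_iff hp _ _
  refine ⟨fun t => min k (Finset.univ.filter fun b => p b < (t : ℕ) + 1).card,
    fun t => ⟨le_min NeZero.one_le ((lt_card t 0).mpr (by omega)), min_le_left _ _⟩,
    fun c a => ?_⟩
  have nonneg (a) : 0 ≤ p a := hp0 ▸ hp (Fin.zero_le a)
  have lt_M (t) (ht : t ∈ Finset.Ico (p c).toNat (p a).toNat) : t < M := by
    have := (hp (Fin.le_last a)).trans hpM
    have := Finset.mem_Ico.mp ht
    omega
  have card_Ico :
      (p a - p c).toNat = ((Finset.Ico (p c).toNat (p a).toNat).attachFin lt_M).card := by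
    rw [Finset.card_attachFin, Nat.card_Ico]
    have := nonneg a
    have := nonneg c
    omega
  rw [card_Ico]
  refine Finset.card_le_card fun t ht => ?_
  have ht := Finset.mem_Ico.mp ((Finset.mem_attachFin _).mp ht)
  have c_lt := (lt_card t c).mpr (by omega)
  have a_ge := (lt_card t a).not.mpr (by omega)
  exact Finset.mem_filter.mpr ⟨Finset.mem_univ t, by dsimp only; omega⟩

lemma exists_toNat_ediv_le_card_filter [NeZero k] (hg : Monotone g)
    (hM : (g (Fin.last k) - g 0) / (k + 1) ≤ M) :
    ∃ i : Fin M → ℕ, (∀ t, 1 ≤ i t ∧ i t ≤ k) ∧ ∀ c a : Fin (k + 1),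
      ((g a - g c) / (k + 1)).toNat ≤
        (Finset.univ.filter fun t => (c : ℕ) < i t ∧ i t ≤ a).card := by
  have period_pos : (0 : ℤ) < k + 1 := by omega
  obtain ⟨i, hi, le_card⟩ := exists_toNat_sub_le_card_filter (p := fun a => (g a - g 0) / (k + 1))
    (fun a b hab => Int.ediv_le_ediv period_pos (sub_le_sub_right (hg hab) _)) (by simp) hM
  refine ⟨i, hi, fun c a => (Int.toNat_le_toNat ?_).trans (le_card c a)⟩
  have := ediv_add_ediv_le (g a - g c) (g c - g 0) period_pos
  rw [sub_add_sub_cancel] at this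
  exact le_sub_iff_add_le.mpr this

lemma IsShape.mem_Y_iff [NeZero k] {lam : YoungDiagram} (h : IsShape g lam) (hg : IsWindow g)
    (m : ℕ) [NeZero m] : lam ∈ Y k m ↔ g (Fin.last k) < g 0 + (k + 1) * m := by
  have width_iff : g (Fin.last k) < g 0 + (k + 1) * m ↔
      (g (Fin.last k) - g 0) / (k + 1) ≤ ((m - 1 : ℕ) : ℤ) := by
    rw [Nat.cast_pred (NeZero.pos m), Int.le_sub_one_iff, Int.ediv_lt_iff_lt_mul (by omega),
      sub_lt_iff_lt_add', mul_comm]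
  rw [width_iff]
  constructor
  · rintro ⟨-, i, hi, hle⟩
    have sum_le (c : Fin (k + 1)) := le_iff_colLen_le.mp hle c
    simp only [h.colLen_eq hg, colLen_ofParts_sum fun j => (hi j).2] at sum_le
    refine (ediv_le_card_filter_of_sum_le sum_le 0).trans (Int.ofNat_le.mpr ?_)
    exact (Finset.card_le_univ _).trans_eq (Fintype.card_fin _)
  · intro hwidth
    obtain ⟨i, hi, hle⟩ := exists_toNat_ediv_le_card_filter hg.strictMono.monotone hwidth
    refine ⟨h.isKBounded, i, hi, le_iff_colLen_le.mpr fun c => ?_⟩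
    rcases Nat.lt_or_ge c (k + 1) with hc | hc
    · rw [colLen_ofParts_sum (fun j => (hi j).2) c, h.colLen_eq hg ⟨c, hc⟩]
      exact Finset.sum_le_sum fun a _ => hle ⟨c, hc⟩ a
    · rw [h.colLen_eq_zero (by omega)]
      exact Nat.zero_le _

end Rect

/-! ### The rotation of windows -/

section RotateWindow

variable {k : ℕ} {g g' : Fin (k + 1) → ℤ} {m : ℕ}

/-- The effect of the rotation of the `m`-fold dilation of the fundamental alcove on windows: the
last entry becomes the first one, translated by `-m` periods, and all entries are shifted by `m` to
restore their sum. -/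
def rotateWindow (m : ℕ) (g : Fin (k + 1) → ℤ) : Fin (k + 1) → ℤ :=
  Fin.cases (g (Fin.last k) - (k + 1) * m + m) fun i => g i.castSucc + m

lemma rotateWindow_zero (m : ℕ) (g : Fin (k + 1) → ℤ) :
    rotateWindow m g 0 = g (Fin.last k) - (k + 1) * m + m := rfl

lemma rotateWindow_succ (m : ℕ) (g : Fin (k + 1) → ℤ) (i : Fin k) :
    rotateWindow m g i.succ = g i.castSucc + m := rfl

lemma rotateWindow_add_one (m : ℕ) (g : Fin (k + 1) → ℤ) (i : Fin (k + 1)) :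
    rotateWindow m g (i + 1) = g i + m - (k + 1) * (if i = Fin.last k then (m : ℤ) else 0) := by
  induction i using Fin.lastCases with
  | last => rw [Fin.last_add_one, rotateWindow_zero, if_pos rfl]; ring
  | cast i => rw [Fin.coeSucc_eq_succ, rotateWindow_succ, if_neg (Fin.castSucc_lt_last i).ne]; ring

lemma rotateWindow_strictMono (hg : StrictMono g) (hm : g (Fin.last k) < g 0 + (k + 1) * m) :
    StrictMono (rotateWindow m g) := by
  intro i j hij
  induction j using Fin.cases with
  | zero => exact absurd hij (Fin.not_lt_zero i)
  | succ j =>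
    induction i using Fin.cases with
    | zero =>
      rw [rotateWindow_zero, rotateWindow_succ]
      linarith [hg.monotone (Fin.zero_le j.castSucc)]
    | succ i =>
      rw [rotateWindow_succ, rotateWindow_succ]
      linarith [hg (Fin.castSucc_lt_castSucc_iff.mpr (Fin.succ_lt_succ_iff.mp hij))]

lemma IsResidueSystem.isResidueSystem_rotateWindow (hg : IsResidueSystem g) (m : ℕ) :
    IsResidueSystem (rotateWindow m g) := by
  refine isResidueSystem_iff_injective.mpr fun i j hij => ?_
  rw [← sub_add_cancel i 1, ← sub_add_cancel j 1] at hij ⊢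
  simp only [rotateWindow_add_one, Int.cast_sub, cast_period_mul, Int.cast_add, sub_zero,
    add_left_inj] at hij
  rw [hg.eq_of_cast_eq hij]

lemma sum_rotateWindow (m : ℕ) (g : Fin (k + 1) → ℤ) : ∑ i, rotateWindow m g i = ∑ i, g i := by
  rw [Fin.sum_univ_succ, Fin.sum_univ_castSucc, rotateWindow_zero]
  simp only [rotateWindow_succ, Finset.sum_add_distrib, Finset.sum_const, Finset.card_univ,
    Fintype.card_fin, nsmul_eq_mul]
  ring

lemma rotateWindow_last_lt [NeZero k] (hg : StrictMono g) (m : ℕ) :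
    rotateWindow m g (Fin.last k) < rotateWindow m g 0 + (k + 1) * m := by
  obtain ⟨j, hj⟩ := Fin.exists_succ_eq.mpr (Fin.last_pos' (n := k)).ne'
  rw [← hj, rotateWindow_succ, rotateWindow_zero]
  linarith [hg (Fin.castSucc_lt_last j)]

lemma IsWindow.isWindow_rotateWindow (hg : IsWindow g)
    (hm : g (Fin.last k) < g 0 + (k + 1) * m) : IsWindow (rotateWindow m g) where
  strictMono := rotateWindow_strictMono hg.strictMono hm
  residue := hg.residue.isResidueSystem_rotateWindow m
  sum := (sum_rotateWindow m g).trans hg.sum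

lemma iterate_rotateWindow (m : ℕ) (g : Fin (k + 1) → ℤ) {t q : ℕ} {i j : Fin (k + 1)}
    (h : (i : ℕ) + t = j + (k + 1) * q) :
    (rotateWindow m)^[t] g j = g i + t * m - (k + 1) * m * q := by
  induction t generalizing j q with
  | zero =>
    have q_eq : q = 0 := by
      by_contra hq
      have := Nat.le_mul_of_pos_right (k + 1) (Nat.pos_of_ne_zero hq)
      omega
    obtain rfl : i = j := Fin.ext (by simpa [q_eq] using h)
    simp [q_eq]
  | succ t ih =>
    rw [Function.iterate_succ_apply']
    induction j using Fin.cases with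
    | zero =>
      obtain _ | q := q
      · simp at h
      rw [rotateWindow_zero, ih (q := q) (by rw [Fin.val_zero] at h; rw [Fin.val_last]; linarith)]
      push_cast
      ring
    | succ j =>
      rw [Fin.val_succ] at h
      rw [rotateWindow_succ, ih (q := q) (by rw [Fin.val_castSucc]; omega)]
      push_cast
      ring

lemma iterate_rotateWindow_period (m : ℕ) (g : Fin (k + 1) → ℤ) :
    (rotateWindow m)^[k + 1] g = g := by
  funext j
  rw [iterate_rotateWindow m g (i := j) (q := 1) (by rw [mul_one])]
  push_cast
  ring

lemma iterate_rotateWindow_id_ne (hm : 1 < m) {t : ℕ} (ht : 0 < t) (htk : t < k + 1) :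
    (rotateWindow m)^[t] (fun i : Fin (k + 1) => ((i : ℕ) : ℤ)) ≠
      fun i : Fin (k + 1) => ((i : ℕ) : ℤ) := by
  intro h
  have entry_eq := iterate_rotateWindow m (fun i : Fin (k + 1) => ((i : ℕ) : ℤ)) (t := t) (q := 1)
    (i := ⟨k + 1 - t, by omega⟩) (j := 0)
    (by rw [Fin.val_zero, Fin.val_mk]; omega)
  rw [h] at entry_eq
  simp only [Fin.val_zero, Nat.cast_zero, Nat.cast_sub htk.le] at entry_eq
  push_cast at entry_eq
  have : ((k : ℤ) + 1 - t) * (m - 1) = 0 := by linarith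
  rcases mul_eq_zero.mp this with h | h <;> omega

lemma rotateWindow_eq_affSwap_iff (c : ZMod (k + 1)) (i : Fin (k + 1)) :
    rotateWindow m g' (i + 1) = affSwap (c + ((m : ℤ) : ZMod (k + 1))) (rotateWindow m g (i + 1)) ↔
      g' i = affSwap c (g i) := by
  have rotate_eq (f : Fin (k + 1) → ℤ) : rotateWindow m f (i + 1) =
      f i + (k + 1) * -(if i = Fin.last k then (m : ℤ) else 0) + m := by
    rw [rotateWindow_add_one]
    ring
  rw [rotate_eq, rotate_eq, affSwap_add_add, affSwap_add_mul, add_left_inj, add_left_inj]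

lemma exists_rotateWindow_eq_affSwap_iff :
    (∃ c : ZMod (k + 1), ∀ j, rotateWindow m g' j = affSwap c (rotateWindow m g j)) ↔
      ∃ c : ZMod (k + 1), ∀ j, g' j = affSwap c (g j) := by
  rw [← (Equiv.addRight ((m : ℤ) : ZMod (k + 1))).exists_congr_right]
  refine exists_congr fun c => ?_
  rw [← (Equiv.addRight (1 : Fin (k + 1))).forall_congr_right]
  exact forall_congr' fun i => rotateWindow_eq_affSwap_iff c i

end RotateWindow

/-! ### The rotation of the dilated fundamental alcove -/

section Rotation

variable {k : ℕ}

/-- The linear part of the rotation of a dilated fundamental alcove. -/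
def rotationLinear (k : ℕ) : V k →ₗ[ℝ] V k where
  toFun x j := rootCoeff x j - rootCoeff x k
  map_add' x y := by
    have rootCoeff_add (a) : rootCoeff (x + y) a = rootCoeff x a + rootCoeff y a := by
      simpa using rootCoeff_sub_smul x y (-1) a
    funext j
    simp only [rootCoeff_add, Pi.add_apply]
    ring
  map_smul' t x := by
    have rootCoeff_smul (a) : rootCoeff (t • x) a = t * rootCoeff x a := by
      cases a <;> simp [rootCoeff]
    funext j
    simp only [rootCoeff_smul, Pi.smul_apply, smul_eq_mul, RingHom.id_apply]
    ring

/-- The rotation of the `m`-fold dilation of the fundamental alcove, as an affine map. Its constant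
term is the vertex `m Λ_1`, the image of `0`. -/
noncomputable def rotationMap (k m : ℕ) : V k →ᵃ[ℝ] V k :=
  (rotationLinear k).toAffineMap +
    AffineMap.const ℝ (V k) fun j : Fin k => (m : ℝ) * (1 - ((j : ℕ) + 1) / (k + 1))

lemma rootCoeff_rotationMap (m : ℕ) (x : V k) {a : ℕ} (ha : a ≤ k) :
    rootCoeff (rotationMap k m x) (a + 1) =
      rootCoeff x a - rootCoeff x k + m * (1 - ((a : ℝ) + 1) / (k + 1)) := by
  rcases ha.lt_or_eq with h | rfl
  · exact rootCoeff_succ (rotationMap k m x) ⟨a, h⟩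
  · have : (a : ℝ) + 1 ≠ 0 := by positivity
    rw [rootCoeff_last, div_self this]
    ring

lemma coord_rotationMap (m : ℕ) (x : V k) (i : Fin (k + 1)) :
    coord (rotationMap k m x) ((i + 1 : Fin (k + 1)) : ℕ) =
      coord x i - m / (k + 1) + (if i = Fin.last k then (m : ℝ) else 0) := by
  have hk : (k : ℝ) + 1 ≠ 0 := by positivity
  induction i using Fin.lastCases with
  | last =>
    rw [Fin.last_add_one, if_pos rfl, coord, coord, Fin.val_zero, Fin.val_last,
      rootCoeff_rotationMap m x (Nat.zero_le k), rootCoeff_last]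
    simp only [rootCoeff]
    push_cast
    field_simp
    ring
  | cast i =>
    rw [Fin.coeSucc_eq_succ, if_neg (Fin.castSucc_lt_last i).ne, coord, coord, Fin.val_succ,
      Fin.val_castSucc, rootCoeff_rotationMap m x (by omega),
      rootCoeff_rotationMap m x (by omega)]
    push_cast
    field_simp
    ring

lemma rotationMap_bijective (k m : ℕ) : Function.Bijective (rotationMap k m) := by
  constructor
  · intro x y hxy
    refine eq_of_coord_eq fun i => ?_
    have coord_eq := coord_rotationMap m x i
    rw [hxy, coord_rotationMap] at coord_eq
    linarith
  · intro y
    have hk : (k : ℝ) + 1 ≠ 0 := by positivity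
    have sum_shift : ∑ i : Fin (k + 1), coord y ((i + 1 : Fin (k + 1)) : ℕ) = 0 :=
      (Equiv.sum_comp (Equiv.addRight (1 : Fin (k + 1))) fun i => coord y (i : ℕ)).trans
        (sum_coord y)
    obtain ⟨x, hx⟩ := exists_coord_eq (k := k)
      (X := fun i => coord y ((i + 1 : Fin (k + 1)) : ℕ) + m / (k + 1)
        - (if i = Fin.last k then (m : ℝ) else 0)) (by
        rw [Finset.sum_sub_distrib, Finset.sum_add_distrib, sum_shift]
        simp [mul_div_cancel₀ _ hk])
    refine ⟨x, eq_of_coord_eq fun i => ?_⟩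
    have coord_eq := coord_rotationMap m x (i - 1)
    rw [hx, sub_add_cancel] at coord_eq
    rw [coord_eq]
    ring

/-- The rotation of the `m`-fold dilation of the fundamental alcove. -/
noncomputable def rotation (k m : ℕ) : V k ≃ᵃ[ℝ] V k :=
  AffineEquiv.ofBijective (rotationMap_bijective k m)

lemma coord_rotation (m : ℕ) (x : V k) (i : Fin (k + 1)) :
    coord (rotation k m x) ((i + 1 : Fin (k + 1)) : ℕ) =
      coord x i - m / (k + 1) + (if i = Fin.last k then (m : ℝ) else 0) :=
  coord_rotationMap m x i

lemma rootCoeff_fundamentalWeight (i : Fin k) {a : ℕ} (ha : a ≤ k + 1) :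
    rootCoeff (fundamentalWeight i) a =
      min ((i : ℝ) + 1) a - ((i : ℝ) + 1) * a / (k + 1) := by
  have hk : (k : ℝ) + 1 ≠ 0 := by positivity
  have hi : ((i : ℕ) : ℝ) + 1 ≤ k := by exact_mod_cast i.isLt
  rcases a with _ | a
  · have : (0 : ℝ) ≤ (i : ℕ) + 1 := by positivity
    simp [rootCoeff, this]
  rcases (Nat.le_of_succ_le_succ ha).lt_or_eq with h | rfl
  · rw [rootCoeff_succ _ ⟨a, h⟩, Nat.cast_succ]
    rfl
  · rw [rootCoeff_last, Nat.cast_succ, min_eq_left (by linarith), mul_div_cancel_right₀ _ hk,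
      sub_self]

lemma coord_fundamentalWeight (i : Fin k) (r : Fin (k + 1)) :
    coord (fundamentalWeight i) r =
      (if r < i.succ then 1 else 0) - ((i.succ : ℕ) : ℝ) / (k + 1) := by
  have hk : (k : ℝ) + 1 ≠ 0 := by positivity
  rw [coord, rootCoeff_fundamentalWeight i (by omega), rootCoeff_fundamentalWeight i (by omega),
    Fin.val_succ]
  push_cast
  split_ifs with h <;> rw [Fin.lt_def, Fin.val_succ] at h
  · have : ((r : ℕ) : ℝ) ≤ (i : ℕ) := by exact_mod_cast Nat.le_of_lt_succ h
    rw [min_eq_right (by linarith), min_eq_right (by linarith)]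
    field_simp
    ring
  · have : ((i : ℕ) : ℝ) + 1 ≤ (r : ℕ) := by exact_mod_cast not_lt.mp h
    rw [min_eq_left (by linarith), min_eq_left this]
    field_simp
    ring

lemma coord_dilatedVertex (m : ℕ) (i r : Fin (k + 1)) :
    coord (dilatedVertex k m i) r =
      m * ((if r < i then 1 else 0) - ((i : ℕ) : ℝ) / (k + 1)) := by
  induction i using Fin.cases with
  | zero =>
    have rootCoeff_zero (a) : rootCoeff (0 : V k) a = 0 := by cases a <;> simp [rootCoeff]
    simp [dilatedVertex, coord, rootCoeff_zero]
  | succ i =>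
    have vertex_eq : dilatedVertex k m i.succ = 0 - (-m : ℝ) • fundamentalWeight i := by
      simp [dilatedVertex]
    have coord_zero : coord (0 : V k) r = 0 := by simpa using coord_sub_smul (0 : V k) 0 (-1) r
    rw [vertex_eq, coord_sub_smul, coord_fundamentalWeight, coord_zero]
    ring

lemma rotation_dilatedVertex (m : ℕ) (i : Fin (k + 1)) :
    rotation k m (dilatedVertex k m i) = dilatedVertex k m (i + 1) := by
  have hk : (k : ℝ) + 1 ≠ 0 := by positivity
  refine eq_of_coord_eq fun r => ?_
  obtain ⟨r, rfl⟩ : ∃ s, r = s + 1 := ⟨r - 1, (sub_add_cancel r 1).symm⟩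
  rw [coord_rotation, coord_dilatedVertex, coord_dilatedVertex]
  induction i using Fin.lastCases <;> induction r using Fin.lastCases <;>
    simp [Fin.castSucc_lt_last, (Fin.castSucc_lt_last _).ne, (Fin.le_last _).not_gt] <;>
    field_simp <;> ring

lemma rotation_mem_windowAlcove_iff {m : ℕ} {g : Fin (k + 1) → ℤ} {x : V k} :
    rotation k m x ∈ windowAlcove (rotateWindow m g) ↔ x ∈ windowAlcove g := by
  constructor
  · intro h i j t hij
    have coord_le := h (i + 1) (j + 1) (t + (if j = Fin.last k then (m : ℤ) else 0)
      - (if i = Fin.last k then (m : ℤ) else 0)) (by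
        rw [rotateWindow_add_one, rotateWindow_add_one]
        linarith)
    rw [coord_rotation, coord_rotation] at coord_le
    push_cast at coord_le
    linarith
  · intro h i j t hij
    obtain ⟨i, rfl⟩ : ∃ s, i = s + 1 := ⟨i - 1, (sub_add_cancel i 1).symm⟩
    obtain ⟨j, rfl⟩ : ∃ s, j = s + 1 := ⟨j - 1, (sub_add_cancel j 1).symm⟩
    rw [rotateWindow_add_one, rotateWindow_add_one] at hij
    have coord_le := h i j (t + (if i = Fin.last k then (m : ℤ) else 0)
      - (if j = Fin.last k then (m : ℤ) else 0)) (by linarith)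
    rw [coord_rotation, coord_rotation]
    push_cast at coord_le
    linarith

lemma rotation_image_windowAlcove (m : ℕ) (g : Fin (k + 1) → ℤ) :
    rotation k m '' windowAlcove g = windowAlcove (rotateWindow m g) := by
  ext y
  obtain ⟨x, rfl⟩ := (rotation k m).surjective y
  rw [rotation_mem_windowAlcove_iff, (rotation k m).injective.mem_set_image]

end Rotation

/-! ### The Hasse diagram -/

section Hasse

variable {k : ℕ} [NeZero k] {g g' : Fin (k + 1) → ℤ} {lam lam' : YoungDiagram}

lemma KCovers.exists_affSwap (hc : KCovers k lam lam') (hg : IsWindow g) (hg' : IsWindow g')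
    (h : IsShape g lam) (h' : IsShape g' lam') :
    ∃ c : ZMod (k + 1), ∀ j, g' j = affSwap c (g j) := by
  obtain ⟨card_eq, kappa, nu, h_kappa, h_nu, i, hi⟩ := hc
  have g_ne : g ≠ g' := by
    rintro rfl
    rw [h.unique h'] at card_eq
    omega
  obtain ⟨_, beadSet_kappa, hlam⟩ := h
  obtain ⟨_, beadSet_nu, hlam'⟩ := h'
  obtain rfl := h_kappa.core_unique hlam
  obtain rfl := h_nu.core_unique hlam'
  have beads_eq := h_kappa.beadClosed.beadSet_coreAct i
  rw [hi, beadSet_nu, beadSet_kappa, image_windowBeads] at beads_eq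
  rcases hg.affSwap_comp_or_range_eq ((i : ℕ) : ZMod (k + 1)) with window | range_eq
  · exact ⟨_, congrFun (hg'.eq_of_windowBeads_eq window beads_eq)⟩
  · rw [windowBeads_eq_of_range_eq range_eq] at beads_eq
    exact absurd (hg.eq_of_windowBeads_eq hg' beads_eq.symm) g_ne

lemma hasseAdj_iff (hg : IsWindow g) (hg' : IsWindow g') (h : IsShape g lam)
    (h' : IsShape g' lam') :
    HasseAdj k lam lam' ↔ ∃ c : ZMod (k + 1), ∀ j, g' j = affSwap c (g j) := by
  constructor
  · rintro (hc | hc)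
    · exact hc.exists_affSwap hg hg' h h'
    · obtain ⟨c, hc⟩ := hc.exists_affSwap hg' hg h' h
      exact ⟨c, fun j => by rw [hc j, affSwap_involutive c]⟩
  · rintro ⟨c, hc⟩
    obtain rfl : g' = fun j => affSwap c (g j) := funext hc
    have card_eq := h.card_affSwap h' hg hg'
    obtain ⟨kappa, beadSet_kappa, hlam⟩ := h
    obtain ⟨nu, beadSet_nu, hlam'⟩ := h'
    obtain ⟨i, rfl⟩ := exists_natCast_eq c
    have act_eq : coreAct i kappa = nu := eq_of_beadSet_eq <| by
      rw [hlam.beadClosed.beadSet_coreAct, beadSet_kappa, beadSet_nu, image_windowBeads]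
    refine card_eq.imp (fun card_eq => ⟨card_eq, kappa, nu, hlam, hlam', i, act_eq⟩)
      fun card_eq => ⟨card_eq, nu, kappa, hlam', hlam, i, ?_⟩
    rw [← act_eq, hlam.beadClosed.coreAct_coreAct]

end Hasse

/-! ### Suter's map -/

section Suter

variable {k : ℕ} {g : Fin (k + 1) → ℤ} {lam lam' mu : YoungDiagram}

lemma toNat_ediv_eq_ite {x r : ℤ} (hr : 0 < r) (hx : x < r * 2) :
    (x / r).toNat = if r ≤ x then 1 else 0 := by
  have ediv_lt_two : x / r < 2 := (Int.ediv_lt_iff_lt_mul hr).mpr (by linarith)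
  have one_le_iff : 1 ≤ x / r ↔ r ≤ x := by rw [Int.le_ediv_iff_mul_le hr, one_mul]
  split_ifs <;> omega

lemma IsShape.colLen_eq_card (h : IsShape g lam) (hg : IsWindow g)
    (h_lt : g (Fin.last k) < g 0 + (k + 1) * 2) (c : Fin (k + 1)) :
    lam.colLen c = (Finset.univ.filter fun i => g c + (k + 1) ≤ g i).card := by
  rw [h.colLen_eq hg, Finset.card_filter]
  refine Finset.sum_congr rfl fun i _ => ?_
  have le_last := hg.strictMono.monotone (Fin.le_last i)
  have zero_le := hg.strictMono.monotone (Fin.zero_le c)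
  rw [toNat_ediv_eq_ite (by omega) (by linarith)]
  simp only [le_sub_iff_add_le']

lemma bead_zero_eq (hg : StrictMono g) (hmu : beadSet mu = windowBeads g) :
    bead mu 0 = g (Fin.last k) - (k + 1) := by
  apply le_antisymm
  · obtain ⟨i, cast_eq, hlt⟩ := hmu ▸ bead_mem mu 0
    linarith [add_period_le cast_eq.symm hlt, hg.monotone (Fin.le_last i)]
  · obtain ⟨r, hr⟩ : g (Fin.last k) - (k + 1) ∈ beadSet mu := by
      rw [hmu]
      exact ⟨Fin.last k, cast_eq_cast_iff_exists.mpr ⟨1, by ring⟩, by omega⟩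
    rw [← hr]
    exact (bead_strictAnti mu).antitone (Nat.zero_le r)

lemma IsShape.rowLen_zero (h : IsShape g lam) (hg : IsWindow g) :
    lam.rowLen 0 = (Finset.univ.filter fun i => g i + (k + 1) < g (Fin.last k)).card := by
  obtain ⟨mu, hmu, hlam⟩ := h
  rw [hlam.rowLen_eq_card hg.residue hmu, bead_zero_eq hg.strictMono hmu]
  simp only [lt_sub_iff_add_lt]

variable [NeZero k]

lemma IsShape.colLen_succ_rotateWindow (h : IsShape g lam) (h' : IsShape (rotateWindow 2 g) lam')
    (hg : IsWindow g) (h_lt : g (Fin.last k) < g 0 + (k + 1) * 2) (c : ℕ) :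
    lam'.colLen (c + 1) = lam.colLen c - 1 := by
  rcases Nat.lt_or_ge c k with hc | hc
  swap
  · rw [h.colLen_eq_zero hc, h'.colLen_eq_zero (by omega)]
  have hg' := hg.isWindow_rotateWindow (m := 2) h_lt
  have colLen_lam := h.colLen_eq_card hg h_lt (Fin.castSucc ⟨c, hc⟩)
  have colLen_lam' := h'.colLen_eq_card hg' (rotateWindow_last_lt hg.strictMono 2)
    (Fin.succ ⟨c, hc⟩)
  have zero_lt := hg'.strictMono (Fin.succ_pos ⟨c, hc⟩)
  rw [Finset.card_filter, Fin.sum_univ_castSucc] at colLen_lam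
  rw [Finset.card_filter, Fin.sum_univ_succ, if_neg (by omega), zero_add] at colLen_lam'
  simp only [rotateWindow_succ, add_right_comm _ _ ((k : ℤ) + 1), add_le_add_iff_right]
    at colLen_lam'
  rw [Fin.val_castSucc] at colLen_lam
  rw [Fin.val_succ] at colLen_lam'
  rw [colLen_lam, colLen_lam']
  split_ifs with h_last
  · exact (Nat.add_sub_cancel _ 1).symm
  · have no_large (i : Fin k) : ¬ g (Fin.castSucc ⟨c, hc⟩) + (k + 1) ≤ g i.castSucc :=
      fun h_le => h_last (h_le.trans (hg.strictMono.monotone (Fin.le_last _)))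
    simp only [no_large, if_false, Finset.sum_const_zero, add_zero, Nat.zero_sub]

lemma IsShape.colLen_zero_rotateWindow_add (h : IsShape g lam)
    (h' : IsShape (rotateWindow 2 g) lam') (hg : IsWindow g)
    (h_lt : g (Fin.last k) < g 0 + (k + 1) * 2) : lam'.colLen 0 + lam.rowLen 0 = k := by
  have colLen_lam' := h'.colLen_eq_card (hg.isWindow_rotateWindow (m := 2) h_lt)
    (rotateWindow_last_lt hg.strictMono 2) 0
  rw [Finset.card_filter, Fin.sum_univ_succ, if_neg (by omega), zero_add, Fin.val_zero]
    at colLen_lam'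
  rw [colLen_lam', h.rowLen_zero hg, Finset.card_filter, Fin.sum_univ_castSucc,
    if_neg (by omega), add_zero, ← Finset.sum_add_distrib]
  refine (Finset.sum_congr rfl fun j _ => (?_ : _ = 1)).trans (by simp)
  have le_iff : rotateWindow 2 g 0 + (k + 1) ≤ rotateWindow 2 g j.succ ↔
      ¬ g j.castSucc + (k + 1) < g (Fin.last k) := by
    rw [rotateWindow_zero, rotateWindow_succ]
    push_cast
    constructor <;> intro <;> linarith
  simp only [le_iff]
  split_ifs <;> rfl

lemma IsShape.rowLen_rotateWindow (h : IsShape g lam) (h' : IsShape (rotateWindow 2 g) lam')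
    (hg : IsWindow g) (h_lt : g (Fin.last k) < g 0 + (k + 1) * 2) (r : ℕ) :
    lam'.rowLen r = if r < k - lam.rowLen 0 then lam.rowLen (r + 1) + 1 else 0 := by
  have colLen_zero := h.colLen_zero_rotateWindow_add h' hg h_lt
  rw [← colLen_zero, Nat.add_sub_cancel]
  refine eq_of_forall_lt_iff fun c => ?_
  rw [← lt_colLen_iff_lt_rowLen]
  cases c with
  | zero => split_ifs <;> omega
  | succ c =>
    have colLen_le := lam'.colLen_anti 0 (c + 1) (Nat.zero_le _)
    have lt_iff := lt_colLen_iff_lt_rowLen lam (r := r + 1) (c := c)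
    rw [h.colLen_succ_rotateWindow h' hg h_lt] at colLen_le ⊢
    split_ifs <;> omega

end Suter

/-! ### The bijections and the cyclic action -/

section BoundedWindows

variable {k m : ℕ}

/-- The windows of the alcoves in the `m`-fold dilation of the fundamental alcove. -/
def boundedWindows (k m : ℕ) : Set (Fin (k + 1) → ℤ) :=
  {g | IsWindow g ∧ g (Fin.last k) < g 0 + (k + 1) * m}

lemma id_mem_boundedWindows (hm : 1 < m) :
    (fun i : Fin (k + 1) => ((i : ℕ) : ℤ)) ∈ boundedWindows k m := by
  refine ⟨isWindow_id, ?_⟩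
  have : ((k : ℤ) + 1) * 1 < (k + 1) * m := mul_lt_mul_of_pos_left (by omega) (by omega)
  simp only [Fin.val_last, Fin.val_zero, Nat.cast_zero]
  linarith

lemma mapsTo_rotateWindow (k m : ℕ) [NeZero k] :
    Set.MapsTo (rotateWindow m) (boundedWindows k m) (boundedWindows k m) :=
  fun _ hg => ⟨hg.1.isWindow_rotateWindow hg.2, rotateWindow_last_lt hg.1.strictMono m⟩

variable [NeZero k]

lemma iterate_restrict_rotateWindow (t : ℕ) (g : boundedWindows k m) :
    (((mapsTo_rotateWindow k m).restrict^[t] g : boundedWindows k m) : Fin (k + 1) → ℤ) =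
      (rotateWindow m)^[t] g := by
  rw [Set.MapsTo.iterate_restrict]
  rfl

lemma iterate_restrict_rotateWindow_period (g : boundedWindows k m) :
    (mapsTo_rotateWindow k m).restrict^[k + 1] g = g :=
  Subtype.ext <| (iterate_restrict_rotateWindow (k + 1) g).trans (iterate_rotateWindow_period m g.1)

/-- The rotation of windows as a permutation of the bounded windows. -/
def rotatePerm (k m : ℕ) [NeZero k] : Equiv.Perm (boundedWindows k m) where
  toFun := (mapsTo_rotateWindow k m).restrict
  invFun := (mapsTo_rotateWindow k m).restrict^[k]
  left_inv := iterate_restrict_rotateWindow_period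
  right_inv g := (Function.iterate_succ_apply' _ k g).symm.trans
    (iterate_restrict_rotateWindow_period g)

lemma rotatePerm_apply (g : boundedWindows k m) :
    (rotatePerm k m g : Fin (k + 1) → ℤ) = rotateWindow m g := rfl

lemma rotatePerm_pow_apply (t : ℕ) (g : boundedWindows k m) :
    ((rotatePerm k m ^ t) g : Fin (k + 1) → ℤ) = (rotateWindow m)^[t] g := by
  rw [Equiv.Perm.coe_pow]
  exact iterate_restrict_rotateWindow t g

lemma orderOf_rotatePerm (hm : 1 < m) : orderOf (rotatePerm k m) = k + 1 := by
  refine (orderOf_eq_iff k.succ_pos).mpr ⟨?_, fun t ht t_pos h => ?_⟩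
  · ext1 g
    exact Subtype.ext (by rw [rotatePerm_pow_apply, iterate_rotateWindow_period]; rfl)
  · have fixed := rotatePerm_pow_apply t ⟨_, id_mem_boundedWindows (k := k) hm⟩
    rw [h] at fixed
    exact iterate_rotateWindow_id_ne hm t_pos ht fixed.symm

/-- The bijection between the bounded windows and the alcoves in the dilated fundamental alcove. -/
noncomputable def alcoveEquiv (k m : ℕ) [NeZero k] : boundedWindows k m ≃ dominantAlcoves k m :=
  Equiv.ofBijective
    (fun g => ⟨windowAlcove g, (mem_dominantAlcoves_iff m _).mpr ⟨g, g.2.1, g.2.2, rfl⟩⟩) <| by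
    constructor
    · intro g g' h
      exact Subtype.ext (g.2.1.eq_of_windowAlcove_eq g'.2.1 (congrArg Subtype.val h))
    · rintro ⟨A, hA⟩
      obtain ⟨g, hg, h_lt, rfl⟩ := (mem_dominantAlcoves_iff m A).mp hA
      exact ⟨⟨g, hg, h_lt⟩, rfl⟩

lemma alcoveEquiv_apply (g : boundedWindows k m) :
    (alcoveEquiv k m g : Set (V k)) = windowAlcove g := rfl

variable [NeZero m]

/-- The bijection between the bounded windows and the partitions in `Y k m`. -/
noncomputable def shapeEquiv (k m : ℕ) [NeZero k] [NeZero m] : boundedWindows k m ≃ Y k m :=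
  Equiv.ofBijective (fun g => ⟨g.2.1.exists_isShape.choose,
      (g.2.1.exists_isShape.choose_spec.mem_Y_iff g.2.1 m).mpr g.2.2⟩) <| by
    constructor
    · intro g g' h
      have shape_eq : g.2.1.exists_isShape.choose = g'.2.1.exists_isShape.choose :=
        congrArg Subtype.val h
      have isShape_g := g.2.1.exists_isShape.choose_spec
      rw [shape_eq] at isShape_g
      exact Subtype.ext (isShape_g.window_unique g.2.1 g'.2.1 g'.2.1.exists_isShape.choose_spec)
    · rintro ⟨lam, hlam⟩
      obtain ⟨g, hg, hs⟩ := exists_window_of_isKBounded hlam.1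
      exact ⟨⟨g, hg, (hs.mem_Y_iff hg m).mp hlam⟩,
        Subtype.ext (hg.exists_isShape.choose_spec.unique hs)⟩

lemma isShape_shapeEquiv (g : boundedWindows k m) :
    IsShape (g : Fin (k + 1) → ℤ) (shapeEquiv k m g : YoungDiagram) :=
  g.2.1.exists_isShape.choose_spec

lemma isShape_shapeEquiv_symm (y : Y k m) :
    IsShape ((shapeEquiv k m).symm y : Fin (k + 1) → ℤ) (y : YoungDiagram) := by
  simpa only [Equiv.apply_symm_apply] using isShape_shapeEquiv ((shapeEquiv k m).symm y)

/-- The correspondence between the partitions in `Y k m` and the alcoves in the dilated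
fundamental alcove. -/
noncomputable def correspondence (k m : ℕ) [NeZero k] [NeZero m] : Y k m ≃ dominantAlcoves k m :=
  (shapeEquiv k m).symm.trans (alcoveEquiv k m)

lemma corresponds_iff_eq_correspondence (y : Y k m) (A : Set (V k)) :
    Corresponds k y A ↔ A = correspondence k m y := by
  rw [corresponds_iff, correspondence, Equiv.trans_apply, alcoveEquiv_apply]
  have hy := ((shapeEquiv k m).symm y).2.1
  constructor
  · rintro ⟨g, hg, rfl, hs⟩
    rw [hs.window_unique hg hy (isShape_shapeEquiv_symm y)]
  · rintro rfl
    exact ⟨_, hy, rfl, isShape_shapeEquiv_symm y⟩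

lemma corresponds_iff_eq_correspondence_symm (lam : YoungDiagram) (a : dominantAlcoves k m) :
    Corresponds k lam a ↔ lam = (correspondence k m).symm a := by
  obtain ⟨g₀, rfl⟩ := (alcoveEquiv k m).surjective a
  rw [corresponds_iff, correspondence, Equiv.symm_trans_apply, Equiv.symm_apply_apply,
    Equiv.symm_symm, alcoveEquiv_apply]
  constructor
  · rintro ⟨g, hg, alcove_eq, hs⟩
    rw [← g₀.2.1.eq_of_windowAlcove_eq hg alcove_eq] at hs
    exact hs.unique (isShape_shapeEquiv g₀)
  · rintro rfl
    exact ⟨_, g₀.2.1, rfl, isShape_shapeEquiv g₀⟩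

/-- The permutation of `Y k m` induced by the rotation of the dilated fundamental alcove. -/
noncomputable def rotatePartition (k m : ℕ) [NeZero k] [NeZero m] : Equiv.Perm (Y k m) :=
  (shapeEquiv k m).permCongr (rotatePerm k m)

lemma shapeEquiv_symm_rotatePartition (y : Y k m) :
    (shapeEquiv k m).symm (rotatePartition k m y) = rotatePerm k m ((shapeEquiv k m).symm y) := by
  rw [rotatePartition, Equiv.permCongr_apply, Equiv.symm_apply_apply]

lemma isShape_rotatePartition (y : Y k m) :
    IsShape (rotateWindow m ((shapeEquiv k m).symm y : Fin (k + 1) → ℤ))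
      (rotatePartition k m y : YoungDiagram) := by
  rw [← rotatePerm_apply, ← shapeEquiv_symm_rotatePartition]
  exact isShape_shapeEquiv_symm _

lemma correspondence_rotatePartition (y : Y k m) :
    (correspondence k m (rotatePartition k m y) : Set (V k)) =
      rotation k m '' (correspondence k m y : Set (V k)) := by
  rw [correspondence, Equiv.trans_apply, Equiv.trans_apply, shapeEquiv_symm_rotatePartition,
    alcoveEquiv_apply, alcoveEquiv_apply, rotatePerm_apply, rotation_image_windowAlcove]

lemma orderOf_rotatePartition (hm : 1 < m) : orderOf (rotatePartition k m) = k + 1 :=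
  ((shapeEquiv k m).permCongrHom.orderOf_eq _).trans (orderOf_rotatePerm hm)

lemma hasseAdj_rotatePartition_iff (y z : Y k m) :
    HasseAdj k (rotatePartition k m y) (rotatePartition k m z) ↔ HasseAdj k y z := by
  have window (y : Y k m) := ((shapeEquiv k m).symm y).2.1
  have rotated_window (y : Y k m) := (rotatePerm k m ((shapeEquiv k m).symm y)).2.1
  rw [hasseAdj_iff (rotated_window y) (rotated_window z) (isShape_rotatePartition y)
      (isShape_rotatePartition z), hasseAdj_iff (window y) (window z) (isShape_shapeEquiv_symm y)
      (isShape_shapeEquiv_symm z)]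
  exact exists_rotateWindow_eq_affSwap_iff

lemma rowLen_rotatePartition (y : Y k 2) (r : ℕ) :
    (rotatePartition k 2 y : YoungDiagram).rowLen r =
      if r < k - (y : YoungDiagram).rowLen 0 then (y : YoungDiagram).rowLen (r + 1) + 1 else 0 :=
  (isShape_shapeEquiv_symm y).rowLen_rotateWindow (isShape_rotatePartition y)
    ((shapeEquiv k 2).symm y).2.1 ((shapeEquiv k 2).symm y).2.2 r

end BoundedWindows

end KBounded

theorem mainTheorem1 (k m : ℕ) (hk : 0 < k) (hm : 1 < m) :
    ∃ (Φ : KBounded.Y k m ≃ KBounded.dominantAlcoves k m)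
      (ρ : KBounded.V k ≃ᵃ[ℝ] KBounded.V k)
      (σ : Equiv.Perm (KBounded.Y k m)),
      -- `Φ` is the correspondence between partitions and dominant alcoves
      (∀ (y : KBounded.Y k m) (A : Set (KBounded.V k)),
        KBounded.Corresponds k y A ↔ A = Φ y) ∧
      (∀ (lam : YoungDiagram) (a : KBounded.dominantAlcoves k m),
        KBounded.Corresponds k lam a ↔ lam = Φ.symm a) ∧
      -- `ρ` rotates the vertices of the `m`-fold dilation of the fundamental alcove
      (∀ i : Fin (k + 1), ρ (KBounded.dilatedVertex k m i) = KBounded.dilatedVertex k m (i + 1)) ∧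
      -- `σ` is induced by `ρ` and generates a cyclic action of order `k + 1`
      (∀ y : KBounded.Y k m, (Φ (σ y) : Set (KBounded.V k)) = ρ '' (Φ y : Set (KBounded.V k))) ∧
      orderOf σ = k + 1 ∧
      -- `σ` is a symmetry of the Hasse diagram
      (∀ y z : KBounded.Y k m,
        KBounded.HasseAdj k (σ y) (σ z) ↔ KBounded.HasseAdj k y z) ∧
      -- for `m = 2` it is Suter's map: delete the first part `y₁`, prepend a column of `k - y₁` cells
      (m = 2 → ∀ (y : KBounded.Y k m) (r : ℕ),
        (σ y : YoungDiagram).rowLen r =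
          if r < k - (y : YoungDiagram).rowLen 0
          then (y : YoungDiagram).rowLen (r + 1) + 1 else 0) := by
  have : NeZero k := ⟨hk.ne'⟩
  have : NeZero m := ⟨(zero_lt_one.trans hm).ne'⟩
  refine ⟨KBounded.correspondence k m, KBounded.rotation k m, KBounded.rotatePartition k m,
    KBounded.corresponds_iff_eq_correspondence, KBounded.corresponds_iff_eq_correspondence_symm,
    KBounded.rotation_dilatedVertex m, KBounded.correspondence_rotatePartition,
    KBounded.orderOf_rotatePartition hm, KBounded.hasseAdj_rotatePartition_iff, ?_⟩
  rintro rfl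
  exact KBounded.rowLen_rotatePartition
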